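/- Let $K$ be a field of characteristic $0$ containing a square root $\sqrt2$ of $2$ (a fixed element $s\in K$ with $s^2=2$), and let $A_n$ be the Weyl algebra over $K$: the algebra, under composition $\circ$, of differential operators on $K[x_1,\dots,x_n]$ generated by the multiplications by $x_1,\dots,x_n$ and the partial derivatives $\partial_1,\dots,\partial_n$. It has the basis of Weyl monomials $x^\alpha\partial^\beta$, $\alpha,\beta\in\mathbb Z_{\ge0}^n$. The monomial $x^\alpha\partial^\beta$ has multi-weight $\alpha-\beta\in\mathbb Z^n$ and weight $\sum_i(\alpha_i-\beta_i)\in\mathbb Z$; let $A_{n,\omega}$ ($\omega\in\mathbb Z^n$) and $A_{n,l}$ ($l\in\mathbb Z$) be the spans of the monomials of multi-weight $\omega$, respectively of weight $l$; write $l(X)=l$ if $X\in A_{n,l}$, and let $X_\omega$ be the projection of $X$ on $A_{n,\omega}$. Let $X\mapsto\overline X$ be the linear map with $\overline{x^\alpha\partial^\beta}=x^\beta\partial^\alpha$, let $T:A_n\to K$ be the linear map with $T(x^\alpha\partial^\alpha)=\alpha!=\alpha_1!\cdots\alpha_n!$ and $T(x^\alpha\partial^\beta)=0$ for $\alpha\ne\beta$,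 and put $(X,Y)=T(X\circ Y)$. Let $\langle\ ,\ \rangle$ be the bilinear form on $A_n$ with $$\langle X,Y\rangle=\sqrt2^{\,l(X)}(X,\overline Y)$$ for all weight-homogeneous $X$ and all $Y$. It has the following properties. 1. Symmetry: $\langle X,Y\rangle=\langle Y,X\rangle$ for all $X,Y\in A_n$. 2. $\langle X,Y\rangle=\langle\overline X,\overline Y\rangle$ for all $X,Y\in A_n$. 3. Positive definiteness: if $K$ is an ordered field (for example $\mathbb R$) and $\sqrt2>0$, then $\langle X,X\rangle\ge0$ for all $X\in A_n$, and $\langle X,X\rangle=0$ implies $X=0$. 4. Invariance: $\langle a\circ X,Y\rangle=\sqrt2^{\,-l(a)}\langle X,\overline a\circ Y\rangle$ and $\langle X\circ a,Y\rangle=\sqrt2^{\,l(a)}\langle X,Y\circ\overline a\rangle$ for all $X,Y\in A_n$ and all weight-homogeneous $a\in A_n$. 5. Distinct multi-weight spaces are orthogonal, and so are distinct weight spaces: if $\omega\neq\omega'$, $X\in A_{n,\omega}$ and $X'\in A_{n,\omega'}$, then $\langle X,X'\rangle=0$, and likewise for $A_{n,l}$, $A_{n,l'}$ with $l\ne l'$.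 In particular $\langle X,Y\rangle=\sum_{\omega\in\mathbb Z^n}\langle X_\omega,Y_\omega\rangle$ for all $X,Y\in A_n$ (a sum with finitely many non-zero terms), and, for $K=\mathbb R$ and $\sqrt2>0$, $|X|^2=\sum_{\omega\in\mathbb Z^n}|X_\omega|^2$, where $|X|=\sqrt{\langle X,X\rangle}$. 6. For decomposable elements $X=X^{(1)}\cdots X^{(n)}$ and $Y=Y^{(1)}\cdots Y^{(n)}$, where $X^{(i)},Y^{(i)}$ lie in the span of the elements $x_i^a\partial_i^b$ ($a,b\in\mathbb Z_{\ge0}$), one has $\langle X,Y\rangle=\prod_{i=1}^n\langle X^{(i)},Y^{(i)}\rangle$. -/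

import Mathlib

namespace Weyl

noncomputable section

variable (n : ℕ) (K : Type*) [Field K]

/-- The polynomial algebra `U_n = K[x_1, …, x_n]`. -/
abbrev Poly := MvPolynomial (Fin n) K

/-- Multiplication by `x_i`, as a linear operator on `K[x_1, …, x_n]`. -/
def xOp (i : Fin n) : Module.End K (Poly n K) := LinearMap.mulLeft K (MvPolynomial.X i)

/-- The partial derivative `∂_i`, as a linear operator on `K[x_1, …, x_n]`. -/
def dOp (i : Fin n) : Module.End K (Poly n K) := (MvPolynomial.pderiv i).toLinearMap

/-- The Weyl algebra `A_n` (over a field of characteristic zero): the algebra of differential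
operators on `K[x_1, …, x_n]` generated by the `x_i` and the `∂_i`, under composition. -/
def weylAlgebra : Subalgebra K (Module.End K (Poly n K)) :=
  Algebra.adjoin K (Set.range (xOp n K) ∪ Set.range (dOp n K))

/-- The Weyl algebra as a type. -/
abbrev A : Type _ := weylAlgebra n K

/-- The generator `x_i` of `A_n`. -/
def x (i : Fin n) : A n K := ⟨xOp n K i, Algebra.subset_adjoin (Or.inl ⟨i, rfl⟩)⟩

/-- The generator `∂_i` of `A_n`. -/
def d (i : Fin n) : A n K := ⟨dOp n K i, Algebra.subset_adjoin (Or.inr ⟨i, rfl⟩)⟩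

/-- Multi-indices `α ∈ ℤ_{≥0}^n`. -/
abbrev MIdx := Fin n →₀ ℕ

/-- The Weyl monomial `x^α ∂^β = x_1^{α_1} ⋯ x_n^{α_n} ∂_1^{β_1} ⋯ ∂_n^{β_n}`, indexed by the
pair `p = (α, β)`. -/
def mono (p : MIdx n × MIdx n) : A n K :=
  (List.ofFn fun i => x n K i ^ p.1 i).prod * (List.ofFn fun i => d n K i ^ p.2 i).prod

/-! The Weyl monomials form a basis of `A_n`. -/

variable {n K}

theorem xOp_pow_monomial (i : Fin n) (k : ℕ) (γ : MIdx n) (c : K) :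
    (xOp n K i ^ k) (MvPolynomial.monomial γ c) =
      MvPolynomial.monomial (γ + Finsupp.single i k) c := by
  induction k with
  | zero => simp
  | succ k ih =>
    rw [pow_succ', Module.End.mul_apply, ih, xOp, LinearMap.mulLeft_apply, MvPolynomial.X,
      MvPolynomial.monomial_mul, one_mul, Finsupp.single_add, add_comm, add_assoc]

theorem dOp_pow_monomial (i : Fin n) (k : ℕ) (γ : MIdx n) (c : K) :
    (dOp n K i ^ k) (MvPolynomial.monomial γ c) =
      MvPolynomial.monomial (γ - Finsupp.single i k) (c * ((γ i).descFactorial k : ℕ)) := by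
  induction k with
  | zero => simp
  | succ k ih =>
    rw [pow_succ', Module.End.mul_apply, ih]
    change MvPolynomial.pderiv i _ = _
    rw [MvPolynomial.pderiv_monomial, Finsupp.single_add, ← tsub_tsub, Nat.descFactorial_succ]
    congr 1
    simp only [Finsupp.coe_tsub, Pi.sub_apply, Finsupp.single_eq_same]
    push_cast
    ring

theorem xList_monomial (α γ : MIdx n) (c : K) (L : List (Fin n)) :
    ((L.map fun i => xOp n K i ^ α i).prod) (MvPolynomial.monomial γ c) =
      MvPolynomial.monomial (γ + (L.map fun i => Finsupp.single i (α i)).sum) c := by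
  induction L with
  | nil => simp
  | cons i L ih =>
    rw [List.map_cons, List.prod_cons, Module.End.mul_apply, ih, xOp_pow_monomial,
      List.map_cons, List.sum_cons, add_assoc, add_comm (List.sum _)]

theorem sum_single_apply_of_notMem (β : MIdx n) (L : List (Fin n)) (i : Fin n) (hi : i ∉ L) :
    ((L.map fun i => Finsupp.single i (β i)).sum) i = 0 := by
  induction L with
  | nil => simp
  | cons j L ih =>
    simp only [List.mem_cons, not_or] at hi
    rw [List.map_cons, List.sum_cons, Finsupp.add_apply, ih hi.2,
      Finsupp.single_eq_of_ne hi.1]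

theorem dList_monomial (β γ : MIdx n) (c : K) (L : List (Fin n)) (hL : L.Nodup) :
    ((L.map fun i => dOp n K i ^ β i).prod) (MvPolynomial.monomial γ c) =
      MvPolynomial.monomial (γ - (L.map fun i => Finsupp.single i (β i)).sum)
        (c * (L.map fun i => (((γ i).descFactorial (β i) : ℕ) : K)).prod) := by
  induction L with
  | nil => simp
  | cons i L ih =>
    rw [List.nodup_cons] at hL
    rw [List.map_cons, List.prod_cons, Module.End.mul_apply, ih hL.2, dOp_pow_monomial,
      List.map_cons, List.sum_cons, List.map_cons, List.prod_cons, tsub_tsub,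
      Finsupp.coe_tsub, Pi.sub_apply, sum_single_apply_of_notMem β L i hL.1, Nat.sub_zero]
    congr 1
    · rw [add_comm]
    · ring

theorem sum_single_finRange (β : MIdx n) :
    ((List.finRange n).map fun i => Finsupp.single i (β i)).sum = β := by
  rw [← List.ofFn_eq_map, List.sum_ofFn]
  exact Finsupp.univ_sum_single β

theorem coe_mono (p : MIdx n × MIdx n) :
    (mono n K p : Module.End K (Poly n K)) =
      ((List.finRange n).map fun i => xOp n K i ^ p.1 i).prod *
        ((List.finRange n).map fun i => dOp n K i ^ p.2 i).prod := by
  rw [mono, List.ofFn_eq_map, List.ofFn_eq_map]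
  rw [Subalgebra.coe_mul, ← Subalgebra.coe_val, map_list_prod, map_list_prod, List.map_map,
    List.map_map]
  rfl

/-- `x^α ∂^β` sends `x^γ` to `γ! / (γ - β)! x^(γ - β + α)`. -/
theorem mono_monomial (p : MIdx n × MIdx n) (γ : MIdx n) (c : K) :
    (mono n K p : Module.End K (Poly n K)) (MvPolynomial.monomial γ c) =
      MvPolynomial.monomial (γ - p.2 + p.1)
        (c * ∏ i, (((γ i).descFactorial (p.2 i) : ℕ) : K)) := by
  rw [coe_mono, Module.End.mul_apply, dList_monomial _ _ _ _ (List.nodup_finRange n),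
    xList_monomial, sum_single_finRange, sum_single_finRange, ← List.ofFn_eq_map, List.prod_ofFn]

theorem end_ext {f g : Module.End K (Poly n K)}
    (h : ∀ γ, f (MvPolynomial.monomial γ 1) = g (MvPolynomial.monomial γ 1)) : f = g :=
  MvPolynomial.linearMap_ext fun γ => LinearMap.ext_ring (h γ)

theorem xOp_mul_mono (i : Fin n) (p : MIdx n × MIdx n) :
    xOp n K i * (mono n K p : Module.End K (Poly n K)) =
      (mono n K (p.1 + Finsupp.single i 1, p.2) : Module.End K (Poly n K)) := by
  refine end_ext fun γ => ?_
  have h := xOp_pow_monomial (K := K) i 1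
  simp only [pow_one] at h
  simp only [Module.End.mul_apply, mono_monomial, h, add_assoc]

theorem prod_descFactorial_add_single (i : Fin n) (β γ : MIdx n) :
    ∏ j, (((γ j).descFactorial ((β + Finsupp.single i 1 : MIdx n) j) : ℕ) : K) =
      (∏ j, (((γ j).descFactorial (β j) : ℕ) : K)) * ((γ i - β i : ℕ) : K) := by
  rw [← Finset.mul_prod_erase _ _ (Finset.mem_univ i),
    ← Finset.mul_prod_erase Finset.univ (fun j => (((γ j).descFactorial (β j) : ℕ) : K))
      (Finset.mem_univ i)]
  have h : ∀ j ∈ Finset.univ.erase i,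
      (((γ j).descFactorial ((β + Finsupp.single i 1 : MIdx n) j) : ℕ) : K) =
        (((γ j).descFactorial (β j) : ℕ) : K) := fun j hj => by
    rw [Finsupp.add_apply, Finsupp.single_eq_of_ne (Finset.ne_of_mem_erase hj), add_zero]
  rw [Finset.prod_congr rfl h, Finsupp.add_apply, Finsupp.single_eq_same,
    Nat.descFactorial_succ]
  push_cast
  ring

theorem dOp_mul_mono (i : Fin n) (p : MIdx n × MIdx n) :
    dOp n K i * (mono n K p : Module.End K (Poly n K)) =
      (mono n K (p.1, p.2 + Finsupp.single i 1) : Module.End K (Poly n K)) +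
        (p.1 i : K) • (mono n K (p.1 - Finsupp.single i 1, p.2) : Module.End K (Poly n K)) := by
  refine end_ext fun γ => ?_
  obtain ⟨α, β⟩ := p
  have h := dOp_pow_monomial (K := K) i 1
  simp only [pow_one, Nat.descFactorial_one] at h
  simp only [Module.End.mul_apply, LinearMap.add_apply, LinearMap.smul_apply, mono_monomial, h,
    one_mul, MvPolynomial.smul_monomial, prod_descFactorial_add_single]
  set P := ∏ j, (((γ j).descFactorial (β j) : ℕ) : K)
  have h1 : MvPolynomial.monomial (γ - (β + Finsupp.single i 1) + α) (P * ((γ i - β i : ℕ) : K)) =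
      MvPolynomial.monomial (γ - β + α - Finsupp.single i 1) (P * ((γ i - β i : ℕ) : K)) := by
    by_cases hz : γ i - β i = 0
    · simp [hz]
    · refine congrArg (fun δ => MvPolynomial.monomial δ _) (Finsupp.ext fun j => ?_)
      by_cases hj : j = i
      · subst hj; simp; omega
      · simp [Finsupp.single_eq_of_ne hj]
  have h2 : MvPolynomial.monomial (γ - β + (α - Finsupp.single i 1)) ((α i : K) • P) =
      MvPolynomial.monomial (γ - β + α - Finsupp.single i 1) ((α i : K) • P) := by
    by_cases hz : α i = 0
    · simp [hz]
    · refine congrArg (fun δ => MvPolynomial.monomial δ _) (Finsupp.ext fun j => ?_)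
      by_cases hj : j = i
      · subst hj; simp; omega
      · simp [Finsupp.single_eq_of_ne hj]
  rw [h1, h2, ← map_add]
  congr 1
  simp only [Finsupp.add_apply, Finsupp.coe_tsub, Pi.sub_apply, smul_eq_mul]
  push_cast
  ring

theorem coe_mono_zero : (mono n K 0 : Module.End K (Poly n K)) = 1 :=
  end_ext fun γ => by rw [mono_monomial]; simp

theorem mem_span_mono {Z : Module.End K (Poly n K)} (hZ : Z ∈ weylAlgebra n K) :
    Z ∈ Submodule.span K
      (Set.range fun p => (mono n K p : Module.End K (Poly n K))) := by
  set M := Submodule.span K (Set.range fun p => (mono n K p : Module.End K (Poly n K)))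
  have hm : ∀ p, (mono n K p : Module.End K (Poly n K)) ∈ M :=
    fun p => Submodule.subset_span ⟨p, rfl⟩
  have key : ∀ m ∈ M, Z * m ∈ M := by
    induction hZ using Algebra.adjoin_induction with
    | mem z hz =>
      intro m hmM
      induction hmM using Submodule.span_induction with
      | mem m hmm =>
        obtain ⟨p, rfl⟩ := hmm
        rcases hz with ⟨i, rfl⟩ | ⟨i, rfl⟩
        · simp only [xOp_mul_mono, hm]
        · simp only [dOp_mul_mono]
          exact M.add_mem (hm _) (M.smul_mem _ (hm _))
      | zero => simp
      | add a b _ _ ha hb => rw [mul_add]; exact M.add_mem ha hb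
      | smul c a _ ha => rw [mul_smul_comm]; exact M.smul_mem _ ha
    | algebraMap r =>
      intro m hmM
      rw [← Algebra.smul_def]
      exact M.smul_mem _ hmM
    | add a b _ _ ha hb =>
      intro m hmM
      rw [add_mul]
      exact M.add_mem (ha m hmM) (hb m hmM)
    | mul a b _ _ ha hb =>
      intro m hmM
      rw [mul_assoc]
      exact ha _ (hb m hmM)
  have h1 := key 1 (by rw [← coe_mono_zero]; exact hm 0)
  rwa [mul_one] at h1

theorem span_mono : ⊤ ≤ Submodule.span K (Set.range (mono n K)) := by
  rintro Z -
  have h := mem_span_mono Z.2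
  have he : (Set.range fun p => (mono n K p : Module.End K (Poly n K))) =
      (weylAlgebra n K).val.toLinearMap '' Set.range (mono n K) := by
    rw [← Set.range_comp]; rfl
  rw [he, Submodule.span_image] at h
  obtain ⟨W, hW, hWZ⟩ := h
  have : W = Z := Subtype.ext hWZ
  exact this ▸ hW

variable (K)

/-- The multi-weight `α - β ∈ ℤ^n` of the monomial `x^α ∂^β`. -/
def multiWeight (p : MIdx n × MIdx n) : Fin n → ℤ := fun i => (p.1 i : ℤ) - p.2 i

/-- The weight `∑ (α_i - β_i) ∈ ℤ` of the monomial `x^α ∂^β`. -/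
def weight (p : MIdx n × MIdx n) : ℤ := ∑ i, ((p.1 i : ℤ) - p.2 i)

/-- `A_{n,ω}`: the span of the monomials of multi-weight `ω ∈ ℤ^n`. -/
def multiWeightSpace (ω : Fin n → ℤ) : Submodule K (A n K) :=
  Submodule.span K {X | ∃ p, multiWeight p = ω ∧ X = mono n K p}

variable (n) in
/-- `A_{n,l}`: the span of the monomials of weight `l ∈ ℤ`. -/
def weightSpace (l : ℤ) : Submodule K (A n K) :=
  Submodule.span K {X | ∃ p, weight p = l ∧ X = mono n K p}

/-- `A_1^{(i)}`: the span of the elements `x_i^a ∂_i^b`, the Weyl algebra in the single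
variable `x_i`. -/
def varSpace (i : Fin n) : Submodule K (A n K) :=
  Submodule.span K {X | ∃ a b : ℕ, X = x n K i ^ a * d n K i ^ b}

variable {K}

variable [CharZero K]

theorem linearIndependent_mono : LinearIndependent K (mono n K) := by
  rw [linearIndependent_iff (R := K) (v := mono n K)]
  intro l hl
  -- by strong induction on the degree of the second index, all coefficients vanish
  have key : ∀ N : ℕ, ∀ β : MIdx n, β.degree = N → ∀ α, l (α, β) = 0 := by
    intro N
    induction N using Nat.strong_induction_on with
    | _ N ih =>
      intro β hβ α
      have h1 := congrArg (fun Z : A n K =>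
        MvPolynomial.coeff α ((Z : Module.End K (Poly n K)) (MvPolynomial.monomial β 1))) hl
      have h2 : MvPolynomial.coeff α
          (((Finsupp.linearCombination K (mono n K) l : A n K) : Module.End K (Poly n K))
            (MvPolynomial.monomial β 1)) =
          l.sum fun p c => c * MvPolynomial.coeff α
            ((mono n K p : Module.End K (Poly n K)) (MvPolynomial.monomial β 1)) := by
        let φ : A n K →ₗ[K] K := (MvPolynomial.lcoeff K α).comp
          ((LinearMap.applyₗ (MvPolynomial.monomial β (1 : K))).comp
            (weylAlgebra n K).val.toLinearMap)
        change φ _ = _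
        rw [Finsupp.linearCombination_apply, map_finsuppSum]
        simp only [map_smul, smul_eq_mul]
        rfl
      rw [h2, Finsupp.sum, Finset.sum_eq_single (α, β)] at h1
      · rw [mono_monomial] at h1
        simp only [tsub_self, zero_add, one_mul, MvPolynomial.coeff_monomial, if_true] at h1
        have h3 : ∏ i, (((β i).descFactorial (β i) : ℕ) : K) ≠ 0 := by
          refine Finset.prod_ne_zero_iff.2 fun i _ => ?_
          rw [Nat.descFactorial_self]
          exact_mod_cast Nat.factorial_ne_zero _
        have h4 : l (α, β) * ∏ i, (((β i).descFactorial (β i) : ℕ) : K) = 0 := by simpa using h1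
        exact (mul_eq_zero.1 h4).resolve_right h3
      · rintro ⟨α', β'⟩ _ hne
        rw [mono_monomial, MvPolynomial.coeff_monomial]
        by_cases hle : β' ≤ β
        · by_cases heq : β' = β
          · subst heq
            rw [if_neg, mul_zero]
            intro h
            apply hne
            simp only [tsub_self, zero_add] at h
            rw [h]
          · have hlt : β'.degree < N := by
              rw [← hβ]
              obtain ⟨δ, rfl⟩ := exists_add_of_le hle
              rw [Finsupp.degree.map_add]
              have : δ.degree ≠ 0 := fun h => heq (by
                rw [Finsupp.degree_eq_zero_iff] at h; simp [h])
              omega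
            rw [ih _ hlt β' rfl α', zero_mul]
        · have : ∃ i, β i < β' i := by
            by_contra! h
            exact hle h
          obtain ⟨i, hi⟩ := this
          rw [Finset.prod_eq_zero (Finset.mem_univ i)]
          · simp
          · rw [Nat.descFactorial_of_lt hi, Nat.cast_zero]
      · intro h
        rw [Finsupp.notMem_support_iff.1 h, zero_mul]
  ext ⟨α, β⟩
  exact key _ β rfl α

variable (n K)

/-- The basis of `A_n` formed by the Weyl monomials `x^α ∂^β`. -/
def monoBasis : Module.Basis (MIdx n × MIdx n) K (A n K) :=
  Module.Basis.mk linearIndependent_mono span_mono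

variable {n}

open scoped Classical in
/-- The projection `X ↦ X_ω` of `A_n` on `A_{n,ω}`: it keeps the monomials of multi-weight `ω`
and kills the others. -/
def proj (ω : Fin n → ℤ) : A n K →ₗ[K] A n K :=
  (monoBasis n K).constr K fun p => if multiWeight p = ω then mono n K p else 0

variable (n)

/-- The linear map `X ↦ X̄` with `x^α ∂^β ↦ x^β ∂^α`. -/
def bar : A n K →ₗ[K] A n K :=
  (monoBasis n K).constr K fun p => mono n K (p.2, p.1)

open scoped Classical in
/-- The linear functional `T` with `T(x^α ∂^α) = α!` and `T(x^α ∂^β) = 0` for `α ≠ β`. -/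
def T : A n K →ₗ[K] K :=
  (monoBasis n K).constr K fun p => if p.1 = p.2 then ((∏ i, (p.1 i).factorial : ℕ) : K) else 0

/-- The bilinear form `(X, Y) = T(X ∘ Y)`. -/
def frob : LinearMap.BilinForm K (A n K) := (LinearMap.mul K (A n K)).compr₂ (T n K)

variable {K}

/-- The linear map that multiplies each `X` of weight `l` by `s ^ l`. -/
def weightScale (s : K) : A n K →ₗ[K] A n K :=
  (monoBasis n K).constr K fun p => s ^ weight p • mono n K p

/-- The bilinear form with `⟨X, Y⟩ = s ^ l(X) (X, Ȳ)` for `X` of weight `l(X)`. It is used with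
`s` a square root of `2`. -/
def euclid (s : K) : LinearMap.BilinForm K (A n K) :=
  (frob n K).compl₁₂ (weightScale n s) (bar n K)

/-- The length `|X| = √⟨X, X⟩`, over the reals. -/
def length (X : A n ℝ) : ℝ := √(euclid n √2 X X)

end

end Weyl

/-! Everything rests on `T` being a twisted trace. Let `scale τ` be the torus automorphism
multiplying `x_i` by `τ i` and `∂_i` by `(τ i)⁻¹`. Then `T (X * Y) = T (Y * scale 2⁻¹ X)`
(`T_mul_comm`), and the form is `T (scale s X * bar Y)` (`euclid_eq`). Since `bar` is an
anti-automorphism that preserves `T` and inverts the torus, symmetry and right invariance hold for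
any nonzero `s`. The equation `s ^ 2 = 2` enters through `2⁻¹ * s = s⁻¹`: moving `scale s X` around
the trace turns it into `scale s⁻¹ X`, which gives invariance under `bar` and left invariance. The
form is torus invariant, so different weights are orthogonal. Elements in disjoint sets of variables
commute and `T` is multiplicative on them, which gives the factorization.

Positivity is a Fock space argument on `A_n` itself. By invariance, the adjoints of `ad ∂_i` and
`-ad x_i` are, up to the factor `s`, the operators `X ↦ 2 x_i X - X x_i` and `X ↦ 2 X ∂_i - ∂_i X`.
These `2n` pairs satisfy the canonical commutation relations, and `1` is a cyclic vacuum of square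
`1`. The number operator then makes the levels orthogonal and carries positivity from each level to
the next (`posDef_of_ladder`). -/

namespace Weyl

noncomputable section

/-! ### Abstract Fock spaces: creation, annihilation and the number operator -/

section Ladder

variable {ι K V : Type*} [Field K] [AddCommMonoid V] [Module K V]

/-- The span of the words of length `k` in the creation operators `C i`, applied to the
vacuum `v`. -/
def ladderSpace (C : ι → Module.End K V) (v : V) : ℕ → Submodule K V
  | 0 => Submodule.span K {v}
  | k + 1 => ⨆ i, (ladderSpace C v k).map (C i)

theorem ladderSpace_create {C : ι → Module.End K V} {v : V} {k : ℕ} {X : V}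
    (hX : X ∈ ladderSpace C v k) (i : ι) : C i X ∈ ladderSpace C v (k + 1) :=
  Submodule.mem_iSup_of_mem i (Submodule.mem_map_of_mem hX)

theorem ladderSpace_succ_induction {C : ι → Module.End K V} {v : V} {k : ℕ} {M : Submodule K V}
    (h : ∀ i, ∀ X ∈ ladderSpace C v k, C i X ∈ M) : ladderSpace C v (k + 1) ≤ M :=
  iSup_le fun i => Submodule.map_le_iff_le_comap.2 fun X hX => h i X hX

variable {C D : ι → Module.End K V} {v : V}

theorem ladderSpace_annihilate_zero (hv : ∀ i, D i v = 0) (i : ι) {X : V}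
    (hX : X ∈ ladderSpace C v 0) : D i X = 0 := by
  obtain ⟨c, rfl⟩ := Submodule.mem_span_singleton.1 hX
  rw [map_smul, hv, smul_zero]

variable [DecidableEq ι]

/-- Moving `D i` to the right through a word deletes one letter at a time and finally kills the
vacuum. -/
theorem ladderSpace_annihilate (hv : ∀ i, D i v = 0)
    (hDC : ∀ i j X, D i (C j X) = C j (D i X) + if i = j then X else 0) (k : ℕ) (i : ι) :
    ∀ X ∈ ladderSpace C v (k + 1), D i X ∈ ladderSpace C v k := by
  induction k with
  | zero =>
    change ladderSpace C v 1 ≤ (ladderSpace C v 0).comap (D i)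
    refine ladderSpace_succ_induction fun j X hX => ?_
    rw [Submodule.mem_comap, hDC, ladderSpace_annihilate_zero hv i hX, map_zero, zero_add]
    split_ifs
    exacts [hX, zero_mem _]
  | succ k ih =>
    change ladderSpace C v (k + 2) ≤ (ladderSpace C v (k + 1)).comap (D i)
    refine ladderSpace_succ_induction fun j X hX => ?_
    rw [Submodule.mem_comap, hDC]
    refine add_mem (ladderSpace_create (ih X hX) j) ?_
    split_ifs
    exacts [hX, zero_mem _]

/-- The relations give `N C_j = C_j N + C_j` for `N = ∑ C_i D_i`, so each letter raises the
eigenvalue of `N` by one. -/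
theorem number_ladderSpace [Fintype ι] (hv : ∀ i, D i v = 0)
    (hDC : ∀ i j X, D i (C j X) = C j (D i X) + if i = j then X else 0)
    (hCC : ∀ i j X, C i (C j X) = C j (C i X)) (k : ℕ) :
    ∀ X ∈ ladderSpace C v k, ∑ i, C i (D i X) = (k : K) • X := by
  induction k with
  | zero =>
    intro X hX
    simp [ladderSpace_annihilate_zero hv _ hX]
  | succ k ih =>
    let N : Module.End K V := ∑ i, C i * D i
    have hN (X : V) : N X = ∑ i, C i (D i X) := by simp [N, LinearMap.sum_apply]
    have : ladderSpace C v (k + 1) ≤ LinearMap.eqLocus N (((k + 1 : ℕ) : K) • LinearMap.id) := by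
      refine ladderSpace_succ_induction fun j X hX => ?_
      rw [LinearMap.mem_eqLocus, hN]
      simp only [hDC, map_add, Finset.sum_add_distrib, hCC _ j]
      rw [← map_sum, ih X hX, Finset.sum_eq_single j (by simp +contextual) (by simp)]
      simp [add_smul]
    intro X hX
    rw [← hN]
    exact this hX

theorem mem_iSup_ladderSpace (hv : ∀ i, D i v = 0)
    (hDC : ∀ i j X, D i (C j X) = C j (D i X) + if i = j then X else 0) (i : ι) {X : V}
    (hX : X ∈ ⨆ k, ladderSpace C v k) :
    C i X ∈ ⨆ k, ladderSpace C v k ∧ D i X ∈ ⨆ k, ladderSpace C v k := by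
  refine ⟨?_, ?_⟩
  · have : (⨆ k, ladderSpace C v k) ≤ (⨆ k, ladderSpace C v k).comap (C i) :=
      iSup_le fun k Y hY => Submodule.mem_iSup_of_mem (k + 1) (ladderSpace_create hY i)
    exact this hX
  · have : (⨆ k, ladderSpace C v k) ≤ (⨆ k, ladderSpace C v k).comap (D i) := by
      refine iSup_le fun k Y hY => ?_
      rw [Submodule.mem_comap]
      cases k with
      | zero => rw [ladderSpace_annihilate_zero hv i hY]; exact zero_mem _
      | succ k => exact Submodule.mem_iSup_of_mem k (ladderSpace_annihilate hv hDC k i Y hY)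
    exact this hX

variable [Fintype ι] [LinearOrder K] [IsStrictOrderedRing K]

/-- A symmetric form for which canonical creation and annihilation operators are mutually adjoint
up to a positive factor is positive definite, provided that the vacuum is cyclic and has positive
square. -/
theorem posDef_of_ladder (B : LinearMap.BilinForm K V) {s : K} (hs : 0 < s)
    (hB : ∀ X Y, B X Y = B Y X) (hvv : 0 < B v v) (hv : ∀ i, D i v = 0)
    (hDC : ∀ i j X, D i (C j X) = C j (D i X) + if i = j then X else 0)
    (hCC : ∀ i j X, C i (C j X) = C j (C i X))
    (hadj : ∀ i X Y, B (C i X) Y = s * B X (D i Y))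
    (htop : ⨆ k, ladderSpace C v k = ⊤) (X : V) : 0 ≤ B X X ∧ (B X X = 0 → X = 0) := by
  -- Pairing `k X = ∑ C_i D_i X` with `Y` and passing `C_i` to the other side. The right-hand side
  -- is symmetric in `X` and `Y`, so two different levels give two different factors for the same
  -- number.
  have number : ∀ k, ∀ X ∈ ladderSpace C v k, ∀ Y,
      (k : K) * B X Y = s * ∑ i, B (D i X) (D i Y) := fun k X hX Y => by
    rw [← smul_eq_mul, ← LinearMap.smul_apply, ← map_smul,
      ← number_ladderSpace hv hDC hCC k X hX, map_sum, LinearMap.sum_apply, Finset.mul_sum]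
    exact Finset.sum_congr rfl fun i _ => hadj _ _ _
  have orth : ∀ k l, k ≠ l → ∀ X ∈ ladderSpace C v k, ∀ Y ∈ ladderSpace C v l, B X Y = 0 := by
    intro k l hkl X hX Y hY
    have h1 := number k X hX Y
    have h2 := number l Y hY X
    have h3 : ((k : K) - l) * B X Y = 0 := by
      rw [sub_mul, h1, hB X Y, h2, sub_eq_zero]
      simp only [hB (D _ Y)]
    exact (mul_eq_zero.1 h3).resolve_left (sub_ne_zero.2 (by exact_mod_cast hkl))
  have pos : ∀ k, ∀ X ∈ ladderSpace C v k, 0 ≤ B X X ∧ (B X X = 0 → X = 0) := by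
    intro k
    induction k with
    | zero =>
      intro X hX
      obtain ⟨c, rfl⟩ := Submodule.mem_span_singleton.1 hX
      simp only [map_smul, LinearMap.smul_apply, smul_eq_mul, ← mul_assoc]
      refine ⟨mul_nonneg (mul_self_nonneg c) hvv.le, fun h => ?_⟩
      rw [mul_self_eq_zero.1 ((mul_eq_zero.1 h).resolve_right hvv.ne'), zero_smul]
    | succ k ih =>
      intro X hX
      have hk : (0 : K) < (k + 1 : ℕ) := by positivity
      have hD := fun i => ih _ (ladderSpace_annihilate hv hDC k i X hX)
      have h1 := number _ X hX X
      have h2 : 0 ≤ ∑ i, B (D i X) (D i X) := Finset.sum_nonneg fun i _ => (hD i).1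
      -- The square of `X` is a positive multiple of the sum of the squares of the `D i X`, which
      -- lie one level lower. If it vanishes, so do all `D i X`, and then so does `(k + 1) X = ∑ C_i
      -- D_i X`.
      refine ⟨nonneg_of_mul_nonneg_right (h1 ▸ mul_nonneg hs.le h2) hk, fun h => ?_⟩
      rw [h, mul_zero, eq_comm, mul_eq_zero, or_iff_right hs.ne',
        Finset.sum_eq_zero_iff_of_nonneg fun i _ => (hD i).1] at h1
      have h3 := number_ladderSpace hv hDC hCC _ X hX
      rw [Finset.sum_eq_zero fun i hi => by rw [(hD i).2 (h1 i hi), map_zero]] at h3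
      rw [← inv_smul_smul₀ hk.ne' X, ← h3, smul_zero]
  obtain ⟨f, hf, rfl⟩ := (Submodule.mem_iSup_iff_exists_finsupp _ X).1
    (htop ▸ Submodule.mem_top : X ∈ ⨆ k, ladderSpace C v k)
  have h : B (f.sum fun _ Y => Y) (f.sum fun _ Y => Y) = ∑ k ∈ f.support, B (f k) (f k) := by
    simp only [Finsupp.sum, map_sum, LinearMap.sum_apply]
    exact Finset.sum_congr rfl fun k hk => Finset.sum_eq_single k
      (fun l _ hlk => orth _ _ hlk _ (hf l) _ (hf k)) fun h => absurd hk h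
  rw [h]
  refine ⟨Finset.sum_nonneg fun k _ => (pos k _ (hf k)).1, fun h0 => ?_⟩
  rw [Finset.sum_eq_zero_iff_of_nonneg fun k _ => (pos k _ (hf k)).1] at h0
  exact Finset.sum_eq_zero fun k hk => (pos k _ (hf k)).2 (h0 k hk)

end Ladder

variable {n : ℕ} {K : Type*} [Field K]

/-! ### Products of Weyl monomials with each other and with generators -/

section Monomials

/-- The hypothesis ensures that no `∂_j` of the left factor has to pass an `x_j` of the right one,
so no commutator terms arise. -/
theorem mono_mul_mono (p q : MIdx n × MIdx n) (h : ∀ j, p.2 j = 0 ∨ q.1 j = 0) :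
    mono n K p * mono n K q = mono n K (p + q) := by
  refine Subtype.ext (end_ext fun γ => ?_)
  rw [Subalgebra.coe_mul, Module.End.mul_apply, mono_monomial, mono_monomial, mono_monomial,
    one_mul, one_mul, ← Finset.prod_mul_distrib]
  congr 1
  · refine congrArg (fun δ => MvPolynomial.monomial δ) (Finsupp.ext fun j => ?_)
    rcases h j with h | h <;> simp [h] <;> omega
  · refine Finset.prod_congr rfl fun j _ => ?_
    rcases h j with h | h
    · simp [h]
    · have : (γ j).descFactorial (p.2 j + q.2 j) =
          (γ j).descFactorial (q.2 j) * (γ j - q.2 j).descFactorial (p.2 j) := by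
        rw [mul_comm, ← Nat.descFactorial_mul_descFactorial (Nat.le_add_left (q.2 j) (p.2 j)),
          Nat.add_sub_cancel]
      simp [h, this]

theorem mono_zero : mono n K 0 = 1 := Subtype.ext coe_mono_zero

theorem x_pow_eq_mono (i : Fin n) (a : ℕ) : x n K i ^ a = mono n K (Finsupp.single i a, 0) := by
  refine Subtype.ext (end_ext fun γ => ?_)
  rw [mono_monomial, Subalgebra.coe_pow, x, xOp_pow_monomial]
  simp

theorem d_pow_eq_mono (i : Fin n) (b : ℕ) : d n K i ^ b = mono n K (0, Finsupp.single i b) := by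
  refine Subtype.ext (end_ext fun γ => ?_)
  rw [mono_monomial, Subalgebra.coe_pow, d, dOp_pow_monomial]
  rw [Finset.prod_eq_single i (fun j _ hj => by simp [Finsupp.single_eq_of_ne hj]) (by simp)]
  simp

theorem x_eq_mono (i : Fin n) : x n K i = mono n K (Finsupp.single i 1, 0) := by
  rw [← x_pow_eq_mono, pow_one]

theorem d_eq_mono (i : Fin n) : d n K i = mono n K (0, Finsupp.single i 1) := by
  rw [← d_pow_eq_mono, pow_one]

theorem x_mul_mono (i : Fin n) (p : MIdx n × MIdx n) :
    x n K i * mono n K p = mono n K (p + (Finsupp.single i 1, 0)) := by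
  rw [x_eq_mono, mono_mul_mono _ _ (by simp), add_comm]

theorem mono_mul_d (i : Fin n) (p : MIdx n × MIdx n) :
    mono n K p * d n K i = mono n K (p + (0, Finsupp.single i 1)) := by
  rw [d_eq_mono, mono_mul_mono _ _ (by simp)]

theorem d_mul_mono (i : Fin n) (p : MIdx n × MIdx n) :
    d n K i * mono n K p = mono n K (p + (0, Finsupp.single i 1)) +
      (p.1 i : K) • mono n K (p - (Finsupp.single i 1, 0)) := by
  refine Subtype.ext ((dOp_mul_mono i p).trans ?_)
  obtain ⟨α, β⟩ := p
  rw [Subalgebra.coe_add, Subalgebra.coe_smul, Prod.mk_add_mk, Prod.mk_sub_mk, add_zero, tsub_zero]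

theorem succ_descFactorial_eq (m k : ℕ) :
    (m + 1).descFactorial k = m.descFactorial k + k * m.descFactorial (k - 1) := by
  cases k with
  | zero => simp
  | succ k =>
    rw [Nat.succ_descFactorial_succ, Nat.descFactorial_succ, Nat.add_sub_cancel, ← add_mul]
    rcases le_or_gt k m with h | h
    · congr 1; omega
    · simp [Nat.descFactorial_of_lt h]

/-- Compared on `x^γ`, this is the recursion `succ_descFactorial_eq` in the variable `i`. -/
theorem mono_mul_x (i : Fin n) (p : MIdx n × MIdx n) :
    mono n K p * x n K i = mono n K (p + (Finsupp.single i 1, 0)) +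
      (p.2 i : K) • mono n K (p - (0, Finsupp.single i 1)) := by
  refine Subtype.ext (end_ext fun γ => ?_)
  rw [x_eq_mono, Subalgebra.coe_mul, Module.End.mul_apply, mono_monomial, mono_monomial,
    Subalgebra.coe_add, Subalgebra.coe_smul, LinearMap.add_apply, LinearMap.smul_apply,
    mono_monomial, mono_monomial, MvPolynomial.smul_monomial]
  obtain ⟨α, β⟩ := p
  simp only [Prod.mk_add_mk, Prod.mk_sub_mk, add_zero, tsub_zero, one_mul, smul_eq_mul,
    Finsupp.coe_zero, Pi.zero_apply, Nat.descFactorial_zero, Nat.cast_one, Finset.prod_const_one]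
  rw [← Finset.mul_prod_erase _ _ (Finset.mem_univ i),
    ← Finset.mul_prod_erase _ (fun j => (((γ j).descFactorial (β j) : ℕ) : K))
      (Finset.mem_univ i),
    ← Finset.mul_prod_erase _
      (fun j => (((γ j).descFactorial ((β - Finsupp.single i 1 : MIdx n) j) : ℕ) : K))
      (Finset.mem_univ i)]
  set P := ∏ j ∈ Finset.univ.erase i, (((γ j).descFactorial (β j) : ℕ) : K)
  have h1 : ∏ j ∈ Finset.univ.erase i,
      ((((γ + Finsupp.single i 1 : MIdx n) j).descFactorial (β j) : ℕ) : K) = P :=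
    Finset.prod_congr rfl fun j hj => by
      simp [Finsupp.single_eq_of_ne (Finset.ne_of_mem_erase hj)]
  have h2 : ∏ j ∈ Finset.univ.erase i,
      (((γ j).descFactorial ((β - Finsupp.single i 1 : MIdx n) j) : ℕ) : K) = P :=
    Finset.prod_congr rfl fun j hj => by
      simp [Finsupp.single_eq_of_ne (Finset.ne_of_mem_erase hj)]
  rw [h1, h2]
  simp only [Finsupp.add_apply, Finsupp.coe_tsub, Pi.sub_apply, Finsupp.single_eq_same]
  rw [succ_descFactorial_eq, Nat.cast_add, add_mul, map_add, Nat.cast_mul, mul_assoc]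
  -- Truncated subtraction can make the two exponents differ, but only where the coefficient is
  -- zero.
  have key : ∀ (μ ν : MIdx n) (c : ℕ) (Q : K), (c ≠ 0 → μ = ν) →
      MvPolynomial.monomial μ ((c : K) * Q) = MvPolynomial.monomial ν ((c : K) * Q) := by
    intro μ ν c Q h
    by_cases hc : c = 0
    · simp [hc]
    · rw [h hc]
  congr 1
  · refine key _ _ _ _ fun h => ?_
    have hi : β i ≤ γ i := by
      by_contra! hlt
      exact h (Nat.descFactorial_of_lt hlt)
    ext j
    by_cases hj : j = i
    · subst hj; simp; omega
    · simp [Finsupp.single_eq_of_ne hj]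
  · refine key _ _ _ _ fun h => ?_
    ext j
    by_cases hj : j = i
    · subst hj; simp; omega
    · simp [Finsupp.single_eq_of_ne hj]

end Monomials

/-! ### Generators, relations and subsets of the variables -/

section Generators

variable (K) in
/-- The subalgebra generated by the `x_i` and `∂_i` with `i ∈ S`. -/
def varAlgebra (S : Set (Fin n)) : Subalgebra K (A n K) :=
  Algebra.adjoin K (x n K '' S ∪ d n K '' S)

variable {S S' : Set (Fin n)}

theorem x_mem_varAlgebra {i : Fin n} (hi : i ∈ S) : x n K i ∈ varAlgebra K S :=
  Algebra.subset_adjoin (Or.inl ⟨i, hi, rfl⟩)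

theorem d_mem_varAlgebra {i : Fin n} (hi : i ∈ S) : d n K i ∈ varAlgebra K S :=
  Algebra.subset_adjoin (Or.inr ⟨i, hi, rfl⟩)

theorem varAlgebra_mono (h : S ⊆ S') : varAlgebra K S ≤ varAlgebra K S' :=
  Algebra.adjoin_mono (Set.union_subset_union (Set.image_mono h) (Set.image_mono h))

@[elab_as_elim]
theorem varAlgebra_induction {P : A n K → Prop} (hx : ∀ i ∈ S, P (x n K i))
    (hd : ∀ i ∈ S, P (d n K i)) (halg : ∀ c, P (algebraMap K _ c))
    (hadd : ∀ X Y, P X → P Y → P (X + Y)) (hmul : ∀ X Y, P X → P Y → P (X * Y)) {X : A n K}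
    (hX : X ∈ varAlgebra K S) : P X := by
  induction hX using Algebra.adjoin_induction with
  | mem X h => rcases h with ⟨i, hi, rfl⟩ | ⟨i, hi, rfl⟩; exacts [hx i hi, hd i hi]
  | algebraMap c => exact halg c
  | add X Y _ _ h1 h2 => exact hadd X Y h1 h2
  | mul X Y _ _ h1 h2 => exact hmul X Y h1 h2

theorem mem_varAlgebra_univ (X : A n K) : X ∈ varAlgebra K Set.univ := by
  have h : Submodule.span K (Set.range (mono n K)) ≤
      Subalgebra.toSubmodule (varAlgebra K (Set.univ : Set (Fin n))) := by
    rw [Submodule.span_le]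
    rintro _ ⟨p, rfl⟩
    refine Subalgebra.mul_mem _ (list_prod_mem fun Y hY => ?_) (list_prod_mem fun Y hY => ?_)
    · obtain ⟨i, rfl⟩ := List.mem_ofFn.1 hY
      exact pow_mem (x_mem_varAlgebra (Set.mem_univ i)) _
    · obtain ⟨i, rfl⟩ := List.mem_ofFn.1 hY
      exact pow_mem (d_mem_varAlgebra (Set.mem_univ i)) _
  exact h (span_mono Submodule.mem_top)

@[elab_as_elim]
theorem weyl_induction {P : A n K → Prop} (X : A n K) (hx : ∀ i, P (x n K i))
    (hd : ∀ i, P (d n K i)) (halg : ∀ c, P (algebraMap K _ c))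
    (hadd : ∀ X Y, P X → P Y → P (X + Y)) (hmul : ∀ X Y, P X → P Y → P (X * Y)) : P X :=
  varAlgebra_induction (fun i _ => hx i) (fun i _ => hd i) halg hadd hmul (mem_varAlgebra_univ X)

/-- A subspace that contains `1` and is stable under left multiplication by generators contains
the algebra they generate. -/
theorem varAlgebra_le_of_stable {M : Submodule K (A n K)} (h1 : 1 ∈ M)
    (hx : ∀ i ∈ S, ∀ Y ∈ M, x n K i * Y ∈ M) (hd : ∀ i ∈ S, ∀ Y ∈ M, d n K i * Y ∈ M)
    {X : A n K} (hX : X ∈ varAlgebra K S) : X ∈ M := by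
  -- Stability of all of `M` under multiplication by `X`, unlike membership of `X`, passes to
  -- products.
  have : ∀ Y ∈ M, X * Y ∈ M := by
    refine varAlgebra_induction (P := fun X => ∀ Y ∈ M, X * Y ∈ M) hx hd (fun c Y hY => ?_)
      (fun X X' h h' Y hY => ?_) (fun X X' h h' Y hY => ?_) hX
    · rw [← Algebra.smul_def]; exact M.smul_mem c hY
    · rw [add_mul]; exact M.add_mem (h Y hY) (h' Y hY)
    · rw [mul_assoc]; exact h _ (h' Y hY)
  simpa using this 1 h1

theorem mem_varAlgebra_of_mem_varSpace {i : Fin n} {X : A n K} (hX : X ∈ varSpace K i) :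
    X ∈ varAlgebra K {i} := by
  have : varSpace K i ≤ Subalgebra.toSubmodule (varAlgebra K {i}) := by
    refine Submodule.span_le.2 ?_
    rintro _ ⟨a, b, rfl⟩
    change _ ∈ varAlgebra K {i}
    exact mul_mem (pow_mem (x_mem_varAlgebra (Set.mem_singleton i)) _)
      (pow_mem (d_mem_varAlgebra (Set.mem_singleton i)) _)
  exact this hX

variable (K) in
/-- The span of the Weyl monomials in which only the `x_i` and `∂_i` with `i ∈ S` occur. -/
def monoSpan (S : Set (Fin n)) : Submodule K (A n K) :=
  Submodule.span K (mono n K '' {p | ∀ j, j ∉ S → p.1 j = 0 ∧ p.2 j = 0})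

theorem mono_mem_monoSpan {p : MIdx n × MIdx n} (h : ∀ j, j ∉ S → p.1 j = 0 ∧ p.2 j = 0) :
    mono n K p ∈ monoSpan K S :=
  Submodule.subset_span ⟨p, h, rfl⟩

theorem monoSpan_le {M : Submodule K (A n K)}
    (h : ∀ p : MIdx n × MIdx n, (∀ j, j ∉ S → p.1 j = 0 ∧ p.2 j = 0) → mono n K p ∈ M) :
    monoSpan K S ≤ M :=
  Submodule.span_le.2 (Set.image_subset_iff.2 h)

/-- Normal ordering introduces no new variables. This reduces bilinear statements about `varAlgebra`
to monomials. -/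
theorem mem_monoSpan_of_mem_varAlgebra {X : A n K} (hX : X ∈ varAlgebra K S) :
    X ∈ monoSpan K S := by
  have hne {i j : Fin n} (hi : i ∈ S) (hj : j ∉ S) : j ≠ i := fun h => hj (h ▸ hi)
  refine varAlgebra_le_of_stable ?_ (fun i hi => ?_) (fun i hi => ?_) hX
  · rw [← mono_zero]
    exact mono_mem_monoSpan fun j _ => ⟨rfl, rfl⟩
  · refine monoSpan_le (M := (monoSpan K S).comap (LinearMap.mulLeft K (x n K i))) fun p hp => ?_
    rw [Submodule.mem_comap, LinearMap.mulLeft_apply, x_mul_mono]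
    refine mono_mem_monoSpan fun j hj => ?_
    simp [hp j hj, Finsupp.single_eq_of_ne (hne hi hj)]
  · refine monoSpan_le (M := (monoSpan K S).comap (LinearMap.mulLeft K (d n K i))) fun p hp => ?_
    rw [Submodule.mem_comap, LinearMap.mulLeft_apply, d_mul_mono]
    refine add_mem (mono_mem_monoSpan fun j hj => ?_)
      (Submodule.smul_mem _ _ (mono_mem_monoSpan fun j hj => ?_))
    · simp [hp j hj, Finsupp.single_eq_of_ne (hne hi hj)]
    · simp [hp j hj]

theorem d_mul_x (i j : Fin n) :
    d n K i * x n K j = x n K j * d n K i + if i = j then 1 else 0 := by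
  rw [x_eq_mono j, d_mul_mono, mono_mul_d]
  split_ifs with h
  · subst h; simp [mono_zero]
  · simp [Finsupp.single_eq_of_ne h]

theorem x_mul_x (i j : Fin n) : x n K i * x n K j = x n K j * x n K i := by
  rw [x_eq_mono j, x_mul_mono, mono_mul_x]; simp

theorem d_mul_d (i j : Fin n) : d n K i * d n K j = d n K j * d n K i := by
  rw [d_eq_mono j, d_mul_mono, mono_mul_d]; simp

theorem commute_of_disjoint (h : Disjoint S S') {X Y : A n K} (hX : X ∈ varAlgebra K S)
    (hY : Y ∈ varAlgebra K S') : Commute X Y := by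
  have hdx {i j : Fin n} (hij : i ≠ j) : Commute (d n K i) (x n K j) := by
    rw [commute_iff_eq, d_mul_x, if_neg hij, add_zero]
  have hne {i j : Fin n} (hi : i ∈ S) (hj : j ∈ S') : i ≠ j := h.ne_of_mem hi hj
  refine varAlgebra_induction (fun i hi => ?_) (fun i hi => ?_)
    (fun c => Algebra.commute_algebraMap_left c Y) (fun _ _ => Commute.add_left)
    (fun _ _ => Commute.mul_left) hX
  · exact varAlgebra_induction (fun j _ => x_mul_x i j) (fun j hj => (hdx (hne hi hj).symm).symm)
      (fun c => Algebra.commute_algebraMap_right c _) (fun _ _ => Commute.add_right)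
      (fun _ _ => Commute.mul_right) hY
  · exact varAlgebra_induction (fun j hj => hdx (hne hi hj)) (fun j _ => d_mul_d i j)
      (fun c => Algebra.commute_algebraMap_right c _) (fun _ _ => Commute.add_right)
      (fun _ _ => Commute.mul_right) hY

end Generators

/-! ### The torus action -/

section Scale

/-- The factor by which the torus element `τ` scales the monomial `x^α ∂^β`. -/
def scaleFactor (τ : Fin n → K) (p : MIdx n × MIdx n) : K := ∏ i, τ i ^ multiWeight p i

variable {τ : Fin n → K}

theorem multiWeight_add (p q : MIdx n × MIdx n) :
    multiWeight (p + q) = multiWeight p + multiWeight q := by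
  ext i; simp [multiWeight]; ring

theorem multiWeight_swap (p : MIdx n × MIdx n) : multiWeight (p.2, p.1) = -multiWeight p := by
  ext i; simp [multiWeight]

theorem scaleFactor_add (hτ : ∀ i, τ i ≠ 0) (p q : MIdx n × MIdx n) :
    scaleFactor τ (p + q) = scaleFactor τ p * scaleFactor τ q := by
  simp only [scaleFactor, multiWeight_add, Pi.add_apply, zpow_add₀ (hτ _), Finset.prod_mul_distrib]

theorem scaleFactor_single_left (i : Fin n) : scaleFactor τ (Finsupp.single i 1, 0) = τ i := by
  rw [scaleFactor, Finset.prod_eq_single i (fun j _ hj => by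
    simp [multiWeight, Finsupp.single_eq_of_ne hj]) (by simp)]
  simp [multiWeight]

theorem scaleFactor_single_right (i : Fin n) :
    scaleFactor τ (0, Finsupp.single i 1) = (τ i)⁻¹ := by
  rw [scaleFactor, Finset.prod_eq_single i (fun j _ hj => by
    simp [multiWeight, Finsupp.single_eq_of_ne hj]) (by simp)]
  simp [multiWeight]

theorem scaleFactor_mul (τ σ : Fin n → K) (p : MIdx n × MIdx n) :
    scaleFactor (τ * σ) p = scaleFactor τ p * scaleFactor σ p := by
  simp only [scaleFactor, Pi.mul_apply, mul_zpow, Finset.prod_mul_distrib]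

theorem scaleFactor_inv (τ : Fin n → K) (p : MIdx n × MIdx n) :
    scaleFactor τ⁻¹ p = scaleFactor τ (p.2, p.1) := by
  simp only [scaleFactor, multiWeight_swap, Pi.inv_apply, Pi.neg_apply, inv_zpow, zpow_neg]

theorem scaleFactor_const {t : K} (ht : t ≠ 0) (p : MIdx n × MIdx n) :
    scaleFactor (fun _ => t) p = t ^ weight p := by
  have h (u : Finset (Fin n)) :
      ∏ i ∈ u, t ^ multiWeight p i = t ^ ∑ i ∈ u, ((p.1 i : ℤ) - p.2 i) := by
    induction u using Finset.cons_induction with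
    | empty => simp
    | cons i u hi ih => rw [Finset.prod_cons, Finset.sum_cons, zpow_add₀ ht, ih, multiWeight]
  exact h _

variable [CharZero K]

theorem linearMap_ext_mono {M : Type*} [AddCommMonoid M] [Module K M] {f g : A n K →ₗ[K] M}
    (h : ∀ p, f (mono n K p) = g (mono n K p)) : f = g :=
  (monoBasis n K).ext fun p => by rw [monoBasis, Module.Basis.mk_apply, h]

theorem constr_mono {M : Type*} [AddCommMonoid M] [Module K M] (f : MIdx n × MIdx n → M)
    (p : MIdx n × MIdx n) : (monoBasis n K).constr K f (mono n K p) = f p := by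
  have : mono n K p = monoBasis n K p := by rw [monoBasis, Module.Basis.mk_apply]
  rw [this, Module.Basis.constr_basis]

/-- The torus action on `A_n`: it scales `x_i` by `τ i` and `∂_i` by `(τ i)⁻¹`. -/
def scale (τ : Fin n → K) : A n K →ₗ[K] A n K :=
  (monoBasis n K).constr K fun p => scaleFactor τ p • mono n K p

theorem scale_mono (τ : Fin n → K) (p : MIdx n × MIdx n) :
    scale τ (mono n K p) = scaleFactor τ p • mono n K p := by
  rw [scale, constr_mono]

theorem scale_one (τ : Fin n → K) : scale τ 1 = 1 := by
  rw [← mono_zero, scale_mono]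
  simp [scaleFactor, multiWeight]

theorem scale_x (τ : Fin n → K) (i : Fin n) : scale τ (x n K i) = τ i • x n K i := by
  rw [x_eq_mono, scale_mono, scaleFactor_single_left]

theorem scale_d (τ : Fin n → K) (i : Fin n) : scale τ (d n K i) = (τ i)⁻¹ • d n K i := by
  rw [d_eq_mono, scale_mono, scaleFactor_single_right]

theorem scale_algebraMap (τ : Fin n → K) (c : K) :
    scale τ (algebraMap K (A n K) c) = algebraMap K (A n K) c := by
  rw [Algebra.algebraMap_eq_smul_one, map_smul, scale_one]

theorem scale_scale (τ σ : Fin n → K) (X : A n K) : scale τ (scale σ X) = scale (τ * σ) X := by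
  have : scale τ ∘ₗ scale σ = scale (τ * σ) := linearMap_ext_mono fun p => by
    rw [LinearMap.comp_apply, scale_mono, scale_mono, map_smul, scale_mono, smul_smul,
      scaleFactor_mul, mul_comm]
  exact LinearMap.congr_fun this X

theorem add_sub_single_left {i : Fin n} {p : MIdx n × MIdx n} (h : p.1 i ≠ 0) :
    p - (Finsupp.single i 1, 0) + (Finsupp.single i 1, 0) = p := by
  refine Prod.ext (Finsupp.ext fun j => ?_) (by simp)
  by_cases hj : j = i
  · subst hj; simp; omega
  · simp [Finsupp.single_eq_of_ne hj]

/-- Quantified over all `Y`, the claim is closed under products in `X`, so it suffices to multiply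
monomials by generators. There it holds because both terms of `∂_i x^α ∂^β` have the same
multi-weight. -/
theorem scale_mul (hτ : ∀ i, τ i ≠ 0) (X Y : A n K) : scale τ (X * Y) = scale τ X * scale τ Y := by
  revert Y
  refine weyl_induction (P := fun X => ∀ Y, scale τ (X * Y) = scale τ X * scale τ Y) X
    (fun i Y => ?_) (fun i Y => ?_) (fun c Y => ?_) (fun X X' h h' Y => ?_) (fun X X' h h' Y => ?_)
  · have : scale τ ∘ₗ LinearMap.mulLeft K (x n K i) =
        LinearMap.mulLeft K (scale τ (x n K i)) ∘ₗ scale τ := linearMap_ext_mono fun p => by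
      simp only [LinearMap.comp_apply, LinearMap.mulLeft_apply, scale_x, scale_mono, x_mul_mono,
        scaleFactor_add hτ, scaleFactor_single_left, smul_mul_smul_comm]
      rw [mul_comm]
    exact LinearMap.congr_fun this Y
  · have : scale τ ∘ₗ LinearMap.mulLeft K (d n K i) =
        LinearMap.mulLeft K (scale τ (d n K i)) ∘ₗ scale τ := linearMap_ext_mono fun p => by
      simp only [LinearMap.comp_apply, LinearMap.mulLeft_apply, scale_d, scale_mono, d_mul_mono,
        map_add, map_smul, scaleFactor_add hτ, scaleFactor_single_right, smul_mul_assoc,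
        smul_add, smul_smul]
      congr 1
      by_cases h : p.1 i = 0
      · simp [h]
      · have hp := scaleFactor_add hτ (p - (Finsupp.single i 1, 0)) (Finsupp.single i 1, 0)
        rw [add_sub_single_left h, scaleFactor_single_left] at hp
        rw [hp]
        congr 1
        field_simp [hτ i]
    exact LinearMap.congr_fun this Y
  · rw [scale_algebraMap, ← Algebra.smul_def, map_smul, Algebra.smul_def]
  · rw [add_mul, map_add, map_add, add_mul, h, h']
  · rw [mul_assoc, h, h', h, mul_assoc]

theorem scale_of_mem_multiWeightSpace (τ : Fin n → K) {ω : Fin n → ℤ} {X : A n K}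
    (hX : X ∈ multiWeightSpace K ω) : scale τ X = (∏ i, τ i ^ ω i) • X := by
  have : multiWeightSpace K ω ≤
      LinearMap.eqLocus (scale τ) ((∏ i, τ i ^ ω i) • LinearMap.id) := by
    refine Submodule.span_le.2 ?_
    rintro _ ⟨p, rfl, rfl⟩
    exact scale_mono τ p
  exact this hX

theorem scale_of_mem_weightSpace {t : K} (ht : t ≠ 0) {l : ℤ} {X : A n K}
    (hX : X ∈ weightSpace n K l) : scale (fun _ => t) X = t ^ l • X := by
  have : weightSpace n K l ≤
      LinearMap.eqLocus (scale fun _ => t) (t ^ l • LinearMap.id) := by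
    refine Submodule.span_le.2 ?_
    rintro _ ⟨p, rfl, rfl⟩
    change scale _ _ = t ^ weight p • mono n K p
    rw [scale_mono, scaleFactor_const ht]
  exact this hX

theorem weightScale_eq_scale {t : K} (ht : t ≠ 0) : weightScale n t = scale fun _ => t :=
  linearMap_ext_mono fun p => by
    rw [scale_mono, scaleFactor_const ht, weightScale, constr_mono]

end Scale

/-! ### The anti-automorphism exchanging `x_i` and `∂_i` -/

section Bar

variable [CharZero K]

theorem bar_mono (p : MIdx n × MIdx n) : bar n K (mono n K p) = mono n K (p.2, p.1) := by
  rw [bar, constr_mono]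

theorem bar_one : bar n K 1 = 1 := by rw [← mono_zero, bar_mono]; rfl

theorem bar_x (i : Fin n) : bar n K (x n K i) = d n K i := by
  rw [x_eq_mono, bar_mono, d_eq_mono]

theorem bar_d (i : Fin n) : bar n K (d n K i) = x n K i := by
  rw [d_eq_mono, bar_mono, x_eq_mono]

theorem bar_algebraMap (c : K) : bar n K (algebraMap K (A n K) c) = algebraMap K (A n K) c := by
  rw [Algebra.algebraMap_eq_smul_one, map_smul, bar_one]

theorem bar_bar (X : A n K) : bar n K (bar n K X) = X := by
  have : bar n K ∘ₗ bar n K = LinearMap.id := linearMap_ext_mono fun p => by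
    rw [LinearMap.comp_apply, bar_mono, bar_mono]; rfl
  exact LinearMap.congr_fun this X

/-- On generators, `bar` exchanges the rules for left multiplication by `x_i` and `∂_i` with those
for right multiplication by `∂_i` and `x_i`. -/
theorem bar_mul (X Y : A n K) : bar n K (X * Y) = bar n K Y * bar n K X := by
  revert Y
  refine weyl_induction (P := fun X => ∀ Y, bar n K (X * Y) = bar n K Y * bar n K X) X
    (fun i Y => ?_) (fun i Y => ?_) (fun c Y => ?_) (fun X X' h h' Y => ?_) (fun X X' h h' Y => ?_)
  · have : bar n K ∘ₗ LinearMap.mulLeft K (x n K i) =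
        LinearMap.mulRight K (bar n K (x n K i)) ∘ₗ bar n K := linearMap_ext_mono fun p => by
      simp only [LinearMap.comp_apply, LinearMap.mulLeft_apply, LinearMap.mulRight_apply, bar_x,
        bar_mono, x_mul_mono, mono_mul_d]
      rfl
    exact LinearMap.congr_fun this Y
  · have : bar n K ∘ₗ LinearMap.mulLeft K (d n K i) =
        LinearMap.mulRight K (bar n K (d n K i)) ∘ₗ bar n K := linearMap_ext_mono fun p => by
      simp only [LinearMap.comp_apply, LinearMap.mulLeft_apply, LinearMap.mulRight_apply, bar_d,
        bar_mono, d_mul_mono, mono_mul_x, map_add, map_smul]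
      rfl
    exact LinearMap.congr_fun this Y
  · rw [bar_algebraMap, ← Algebra.smul_def, map_smul, Algebra.smul_def, Algebra.commutes]
  · rw [add_mul, map_add, map_add, mul_add, h, h']
  · rw [mul_assoc, h, h', h, mul_assoc]

theorem bar_scale (τ : Fin n → K) (X : A n K) :
    bar n K (scale τ X) = scale τ⁻¹ (bar n K X) := by
  have : bar n K ∘ₗ scale τ = scale τ⁻¹ ∘ₗ bar n K := linearMap_ext_mono fun p => by
    rw [LinearMap.comp_apply, LinearMap.comp_apply, scale_mono, map_smul, bar_mono, scale_mono,
      scaleFactor_inv]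
  exact LinearMap.congr_fun this X

end Bar

/-! ### The functional `T` as a twisted trace -/

section Functional

variable [CharZero K]

open scoped Classical in
theorem T_mono (p : MIdx n × MIdx n) :
    T n K (mono n K p) = ∏ i, if p.1 i = p.2 i then ((p.1 i).factorial : K) else 0 := by
  rw [T, constr_mono]
  split_ifs with h
  · rw [Nat.cast_prod]
    exact Finset.prod_congr rfl fun i _ => by rw [if_pos (by rw [h])]
  · obtain ⟨i, hi⟩ := Finsupp.ne_iff.1 h
    rw [Finset.prod_eq_zero (Finset.mem_univ i) (if_neg hi)]

theorem T_one : T n K 1 = 1 := by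
  rw [← mono_zero, T_mono]; simp

theorem T_bar (X : A n K) : T n K (bar n K X) = T n K X := by
  have : T n K ∘ₗ bar n K = T n K := linearMap_ext_mono fun p => by
    rw [LinearMap.comp_apply, bar_mono, T_mono, T_mono]
    refine Finset.prod_congr rfl fun i _ => ?_
    by_cases h : p.1 i = p.2 i
    · simp [h]
    · rw [if_neg h, if_neg (Ne.symm h)]
  exact LinearMap.congr_fun this X

/-- `T` only sees multi-weight zero, where the torus acts trivially. -/
theorem T_scale {τ : Fin n → K} (X : A n K) : T n K (scale τ X) = T n K X := by
  have : T n K ∘ₗ scale τ = T n K := linearMap_ext_mono fun p => by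
    rw [LinearMap.comp_apply, scale_mono, map_smul, T_mono, smul_eq_mul, scaleFactor,
      ← Finset.prod_mul_distrib]
    refine Finset.prod_congr rfl fun i _ => ?_
    split_ifs with h
    · simp [multiWeight, h]
    · rw [mul_zero]
  exact LinearMap.congr_fun this X

/-- Both sides vanish unless `β = α + e_i`, and then `β! = β_i (β - e_i)!`. -/
theorem T_mono_add_single_left (i : Fin n) (p : MIdx n × MIdx n) :
    T n K (mono n K (p + (Finsupp.single i 1, 0))) =
      p.2 i * T n K (mono n K (p - (0, Finsupp.single i 1))) := by
  rw [T_mono, T_mono, ← Finset.mul_prod_erase _ _ (Finset.mem_univ i),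
    ← Finset.mul_prod_erase Finset.univ _ (Finset.mem_univ i), ← mul_assoc]
  congr 1
  · simp only [Prod.fst_add, Prod.snd_add, Prod.fst_sub, Prod.snd_sub, Finsupp.add_apply,
      Finsupp.single_eq_same, add_zero, tsub_zero, Finsupp.coe_tsub, Pi.sub_apply]
    rcases h : p.2 i with _ | b
    · simp
    · by_cases hb : p.1 i = b
      · simp [hb, Nat.factorial_succ]
      · simp [hb]
  · refine Finset.prod_congr rfl fun j hj => ?_
    simp [Finsupp.single_eq_of_ne (Finset.ne_of_mem_erase hj)]

/-- The origin of the factor `2`: in `X x_i = x_i X + (commutator)`, with `X` a monomial, `T` takes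
the same value on both terms. -/
theorem T_x_mul (i : Fin n) (X : A n K) : T n K (x n K i * X) = 2⁻¹ * T n K (X * x n K i) := by
  have : T n K ∘ₗ LinearMap.mulLeft K (x n K i) =
      (2⁻¹ : K) • T n K ∘ₗ LinearMap.mulRight K (x n K i) := linearMap_ext_mono fun p => by
    simp only [LinearMap.comp_apply, LinearMap.smul_apply, LinearMap.mulLeft_apply,
      LinearMap.mulRight_apply, x_mul_mono, mono_mul_x, map_add, map_smul, smul_eq_mul,
      ← T_mono_add_single_left]
    ring
  exact LinearMap.congr_fun this X

theorem T_d_mul (i : Fin n) (X : A n K) : T n K (d n K i * X) = 2 * T n K (X * d n K i) := by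
  rw [← T_bar (d n K i * X), ← T_bar (X * d n K i), bar_mul, bar_mul, bar_d, T_x_mul]
  ring

/-- `T` is a twisted trace. -/
theorem T_mul_comm (X Y : A n K) : T n K (X * Y) = T n K (Y * scale (fun _ => 2⁻¹) X) := by
  have h2 : ∀ i : Fin n, (fun _ => (2⁻¹ : K)) i ≠ 0 := fun _ => by simp
  revert Y
  refine weyl_induction (P := fun X => ∀ Y, T n K (X * Y) = T n K (Y * scale (fun _ => 2⁻¹) X)) X
    (fun i Y => ?_) (fun i Y => ?_) (fun c Y => ?_) (fun X X' h h' Y => ?_) (fun X X' h h' Y => ?_)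
  · rw [scale_x, mul_smul_comm, map_smul, T_x_mul, smul_eq_mul]
  · rw [scale_d, mul_smul_comm, map_smul, T_d_mul, smul_eq_mul, inv_inv]
  · rw [scale_algebraMap, Algebra.commutes]
  · rw [add_mul, map_add, map_add, mul_add, map_add, h, h']
  · rw [mul_assoc, h, mul_assoc, h', scale_mul h2, mul_assoc]

/-- `T` is multiplicative on products of elements in disjoint sets of variables. -/
theorem T_mul_of_disjoint {S S' : Set (Fin n)} (h : Disjoint S S') {X Y : A n K}
    (hX : X ∈ varAlgebra K S) (hY : Y ∈ varAlgebra K S') :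
    T n K (X * Y) = T n K X * T n K Y := by
  have key : ∀ p : MIdx n × MIdx n, (∀ j, j ∉ S → p.1 j = 0 ∧ p.2 j = 0) →
      ∀ q : MIdx n × MIdx n, (∀ j, j ∉ S' → q.1 j = 0 ∧ q.2 j = 0) →
      T n K (mono n K p * mono n K q) = T n K (mono n K p) * T n K (mono n K q) := by
    intro p hp q hq
    have hpq (j : Fin n) : (p.1 j = 0 ∧ p.2 j = 0) ∨ (q.1 j = 0 ∧ q.2 j = 0) := by
      by_cases hj : j ∈ S
      · exact Or.inr (hq j (Set.disjoint_left.1 h hj))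
      · exact Or.inl (hp j hj)
    rw [mono_mul_mono _ _ fun j => (hpq j).imp And.right And.left, T_mono, T_mono, T_mono,
      ← Finset.prod_mul_distrib]
    refine Finset.prod_congr rfl fun j _ => ?_
    rcases hpq j with ⟨h1, h2⟩ | ⟨h1, h2⟩ <;> simp [h1, h2]
  let f : A n K →ₗ[K] A n K →ₗ[K] K :=
    (LinearMap.mul K (A n K)).compr₂ (T n K) - (LinearMap.mul K K).compl₁₂ (T n K) (T n K)
  have hf (X Y : A n K) : f X Y = T n K (X * Y) - T n K X * T n K Y := rfl
  have h1 : monoSpan K S ≤ ⨅ q : {q : MIdx n × MIdx n // ∀ j, j ∉ S' → q.1 j = 0 ∧ q.2 j = 0},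
      LinearMap.ker (f.flip (mono n K q)) := monoSpan_le fun p hp => by
    simp only [Submodule.mem_iInf, LinearMap.mem_ker, LinearMap.flip_apply]
    rintro ⟨q, hq⟩
    rw [hf, key p hp q hq, sub_self]
  have h2 : monoSpan K S' ≤ LinearMap.ker (f X) := monoSpan_le fun q hq => by
    have := h1 (mem_monoSpan_of_mem_varAlgebra hX)
    rw [Submodule.mem_iInf] at this
    exact this ⟨q, hq⟩
  have h3 := h2 (mem_monoSpan_of_mem_varAlgebra hY)
  rwa [LinearMap.mem_ker, hf, sub_eq_zero] at h3

end Functional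

/-! ### The canonical commutation relations on the Weyl algebra -/

section LadderOperators

theorem x_mem_weightSpace (i : Fin n) : x n K i ∈ weightSpace n K 1 := by
  refine Submodule.subset_span ⟨(Finsupp.single i 1, 0), ?_, x_eq_mono i⟩
  rw [weight, Finset.sum_eq_single i (fun j _ hj => by simp [Finsupp.single_eq_of_ne hj]) (by simp)]
  simp

theorem d_mem_weightSpace (i : Fin n) : d n K i ∈ weightSpace n K (-1) := by
  refine Submodule.subset_span ⟨(0, Finsupp.single i 1), ?_, d_eq_mono i⟩
  rw [weight, Finset.sum_eq_single i (fun j _ hj => by simp [Finsupp.single_eq_of_ne hj]) (by simp)]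
  simp

variable (n K) in
/-- The creation operators of the form: the adjoints of `ad ∂_i` and `-ad x_i`, up to a factor. -/
def create : Fin n ⊕ Fin n → Module.End K (A n K)
  | .inl i => (2 : K) • LinearMap.mulLeft K (x n K i) + (-1 : K) • LinearMap.mulRight K (x n K i)
  | .inr i => (2 : K) • LinearMap.mulRight K (d n K i) + (-1 : K) • LinearMap.mulLeft K (d n K i)

variable (n K) in
/-- The annihilation operators `ad ∂_i` and `-ad x_i`: the partial derivatives of symbols. -/
def annihilate : Fin n ⊕ Fin n → Module.End K (A n K)
  | .inl i => LinearMap.mulLeft K (d n K i) + (-1 : K) • LinearMap.mulRight K (d n K i)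
  | .inr i => LinearMap.mulRight K (x n K i) + (-1 : K) • LinearMap.mulLeft K (x n K i)

theorem create_inl (i : Fin n) (X : A n K) :
    create n K (.inl i) X = (2 : K) • (x n K i * X) + (-1 : K) • (X * x n K i) := rfl

theorem create_inr (i : Fin n) (X : A n K) :
    create n K (.inr i) X = (2 : K) • (X * d n K i) + (-1 : K) • (d n K i * X) := rfl

theorem annihilate_inl (i : Fin n) (X : A n K) :
    annihilate n K (.inl i) X = d n K i * X + (-1 : K) • (X * d n K i) := rfl

theorem annihilate_inr (i : Fin n) (X : A n K) :
    annihilate n K (.inr i) X = X * x n K i + (-1 : K) • (x n K i * X) := rfl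

theorem annihilate_one (j : Fin n ⊕ Fin n) : annihilate n K j 1 = 0 := by
  rcases j with i | i
  · rw [annihilate_inl, one_mul, mul_one]; module
  · rw [annihilate_inr, one_mul, mul_one]; module

theorem d_mul_x_mul (i j : Fin n) (X : A n K) : d n K i * (x n K j * X) =
    x n K j * (d n K i * X) + (if i = j then 1 else 0 : K) • X := by
  rw [← mul_assoc, d_mul_x, add_mul, mul_assoc, ite_mul, one_mul, zero_mul, ite_smul, one_smul,
    zero_smul]

theorem mul_d_mul_x (i j : Fin n) (X : A n K) : X * (d n K i * x n K j) =
    X * (x n K j * d n K i) + (if i = j then 1 else 0 : K) • X := by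
  rw [d_mul_x, mul_add, mul_ite, mul_one, mul_zero, ite_smul, one_smul, zero_smul]

theorem x_mul_x_mul (i j : Fin n) (X : A n K) :
    x n K i * (x n K j * X) = x n K j * (x n K i * X) := by
  rw [← mul_assoc, x_mul_x, mul_assoc]

theorem d_mul_d_mul (i j : Fin n) (X : A n K) :
    d n K i * (d n K j * X) = d n K j * (d n K i * X) := by
  rw [← mul_assoc, d_mul_d, mul_assoc]

/-- In the mixed case, the commutators of the two left multiplications and of the two right
multiplications have opposite signs and equal coefficients, so they cancel. -/
theorem create_comm (i j : Fin n ⊕ Fin n) (X : A n K) :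
    create n K i (create n K j X) = create n K j (create n K i X) := by
  rcases i with i | i <;> rcases j with j | j <;>
    simp only [create_inl, create_inr, mul_add, add_mul, mul_smul_comm, smul_mul_assoc, mul_assoc,
      d_mul_x_mul, mul_d_mul_x]
  · rw [x_mul_x_mul i j, x_mul_x i j]
    module
  · module
  · module
  · rw [d_mul_d_mul i j, d_mul_d i j]
    module

/-- For equal indices, one side multiplication contributes `2` and the other `-1`, which leaves
exactly `1`. -/
theorem annihilate_create (i j : Fin n ⊕ Fin n) (X : A n K) :
    annihilate n K i (create n K j X) =
      create n K j (annihilate n K i X) + if i = j then X else 0 := by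
  have h : (if i = j then X else 0) = (if i = j then 1 else 0 : K) • X := by
    rw [ite_smul, one_smul, zero_smul]
  rw [h]
  rcases i with i | i <;> rcases j with j | j <;>
    simp only [create_inl, create_inr, annihilate_inl, annihilate_inr, mul_add, add_mul,
      mul_smul_comm, smul_mul_assoc, mul_assoc, d_mul_x_mul, mul_d_mul_x, Sum.inl.injEq,
      Sum.inr.injEq, reduceCtorEq, if_false, eq_comm (a := j)]
  · module
  · rw [d_mul_d_mul i j, d_mul_d i j]
    module
  · rw [x_mul_x_mul i j, x_mul_x i j]
    module
  · module

/-- Left multiplications by generators are combinations of ladder operators, so the span of all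
levels is a left ideal containing `1`. -/
theorem iSup_ladderSpace_create : ⨆ k, ladderSpace (create n K) 1 k = ⊤ := by
  refine eq_top_iff.2 fun X _ => ?_
  have h (i) {Y : A n K} := mem_iSup_ladderSpace (X := Y) annihilate_one annihilate_create i
  refine varAlgebra_le_of_stable ?_ (fun i _ Y hY => ?_) (fun i _ Y hY => ?_)
    (mem_varAlgebra_univ X)
  · exact Submodule.mem_iSup_of_mem 0 (Submodule.mem_span_singleton_self _)
  · have : x n K i * Y = create n K (.inl i) Y + annihilate n K (.inr i) Y := by
      rw [create_inl, annihilate_inr]; module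
    rw [this]
    exact add_mem (h _ hY).1 (h _ hY).2
  · have : d n K i * Y = create n K (.inr i) Y + (2 : K) • annihilate n K (.inl i) Y := by
      rw [create_inr, annihilate_inl]; module
    rw [this]
    exact add_mem (h _ hY).1 (Submodule.smul_mem _ _ (h _ hY).2)

end LadderOperators

variable [CharZero K] {s : K}

/-! ### Symmetry, invariance and orthogonality of the form -/

theorem ne_zero_of_sq_eq_two (hs : s ^ 2 = 2) : s ≠ 0 := by
  rintro rfl
  norm_num at hs

theorem euclid_eq (hs : s ≠ 0) (X Y : A n K) :
    euclid n s X Y = T n K (scale (fun _ => s) X * bar n K Y) := by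
  rw [← weightScale_eq_scale hs]
  rfl

theorem euclid_of_mem_weightSpace (hs : s ≠ 0) {l : ℤ} {X : A n K} (hX : X ∈ weightSpace n K l)
    (Y : A n K) : euclid n s X Y = s ^ l * frob n K X (bar n K Y) := by
  rw [euclid_eq hs, scale_of_mem_weightSpace hs hX, smul_mul_assoc, map_smul]
  rfl

theorem bar_scale_const (X : A n K) :
    bar n K (scale (fun _ => s) X) = scale (fun _ => s⁻¹) (bar n K X) := bar_scale _ X

/-- Applying `bar` under `T` reverses the product and leaves `scale s⁻¹` on `bar X`; applying `scale
s` under `T` moves the twist onto `Y`. -/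
theorem euclid_comm (hs : s ≠ 0) (X Y : A n K) : euclid n s X Y = euclid n s Y X := by
  have hs' : ∀ i : Fin n, (fun _ => s) i ≠ 0 := fun _ => hs
  rw [euclid_eq hs, euclid_eq hs, ← T_bar, bar_mul, bar_bar, bar_scale_const,
    ← T_scale (τ := fun _ => s), scale_mul hs', scale_scale]
  have : (fun _ => s : Fin n → K) * (fun _ => s⁻¹) = fun _ => 1 := by
    ext; simp [hs]
  rw [this]
  have h1 : scale (fun _ => (1 : K)) (bar n K X) = bar n K X := by
    have : scale (fun _ => (1 : K)) = (LinearMap.id : A n K →ₗ[K] A n K) :=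
      linearMap_ext_mono fun p => by
        rw [scale_mono]
        simp [scaleFactor]
    rw [this]
    rfl
  rw [h1]

/-- The one consequence of the twisted trace that needs `s ^ 2 = 2`, in the form `2⁻¹ * s = s⁻¹`. -/
theorem T_scale_mul_comm (hs : s ^ 2 = 2) (X Y : A n K) :
    T n K (scale (fun _ => s) X * Y) = T n K (Y * scale (fun _ => s⁻¹) X) := by
  have : (fun _ => 2⁻¹ : Fin n → K) * (fun _ => s) = fun _ => s⁻¹ := by
    ext
    have := ne_zero_of_sq_eq_two hs
    simp only [Pi.mul_apply, ← hs]
    field_simp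
  rw [T_mul_comm, scale_scale, this]

theorem euclid_bar (hs : s ^ 2 = 2) (X Y : A n K) :
    euclid n s X Y = euclid n s (bar n K X) (bar n K Y) := by
  have h0 := ne_zero_of_sq_eq_two hs
  rw [euclid_eq h0, euclid_eq h0, ← T_bar, bar_mul, bar_bar, bar_scale_const, T_scale_mul_comm hs]

theorem euclid_mul_left (hs : s ^ 2 = 2) {l : ℤ} {a : A n K} (ha : a ∈ weightSpace n K l)
    (X Y : A n K) : euclid n s (a * X) Y = s ^ (-l) * euclid n s X (bar n K a * Y) := by
  have h0 := ne_zero_of_sq_eq_two hs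
  rw [euclid_eq h0, euclid_eq h0, scale_mul fun _ => h0, mul_assoc, T_scale_mul_comm hs,
    scale_of_mem_weightSpace (inv_ne_zero h0) ha, mul_smul_comm, map_smul, bar_mul, bar_bar,
    mul_assoc, smul_eq_mul, inv_zpow, zpow_neg]

theorem euclid_mul_right (hs : s ≠ 0) {l : ℤ} {a : A n K} (ha : a ∈ weightSpace n K l)
    (X Y : A n K) : euclid n s (X * a) Y = s ^ l * euclid n s X (Y * bar n K a) := by
  rw [euclid_eq hs, euclid_eq hs, scale_mul fun _ => hs, scale_of_mem_weightSpace hs ha,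
    mul_smul_comm, smul_mul_assoc, map_smul, bar_mul, bar_bar, mul_assoc, smul_eq_mul]

/-- The form is invariant under the torus, acting contragrediently on the second argument. -/
theorem euclid_scale (hs : s ≠ 0) {τ : Fin n → K} (hτ : ∀ i, τ i ≠ 0) (X Y : A n K) :
    euclid n s (scale τ X) (scale τ⁻¹ Y) = euclid n s X Y := by
  rw [euclid_eq hs, euclid_eq hs, bar_scale, inv_inv, scale_scale, mul_comm, ← scale_scale,
    ← scale_mul hτ, T_scale]

theorem two_zpow_eq_one {k : ℤ} (h : (2 : K) ^ k = 1) : k = 0 := by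
  have h1 : ((2 ^ k : ℚ) : K) = ((1 : ℚ) : K) := by push_cast; exact h
  have h2 : (2 : ℚ) ^ k = 2 ^ (0 : ℤ) := by rw [zpow_zero]; exact Rat.cast_injective h1
  exact zpow_right_injective₀ (by norm_num) (by norm_num) h2

theorem euclid_eq_zero_of_multiWeight_ne (hs : s ≠ 0) {ω ω' : Fin n → ℤ} (h : ω ≠ ω')
    {X Y : A n K} (hX : X ∈ multiWeightSpace K ω) (hY : Y ∈ multiWeightSpace K ω') :
    euclid n s X Y = 0 := by
  obtain ⟨i, hi⟩ := Function.ne_iff.1 h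
  -- The torus element with `2` in a coordinate `i` where the multi-weights differ. Torus invariance
  -- multiplies the form by `2 ^ (ω i - ω' i)`, which is not `1` in characteristic zero.
  have hτ : ∀ j, Function.update (1 : Fin n → K) i 2 j ≠ 0 := fun j => by
    by_cases hj : j = i
    · subst hj; simp
    · simp [hj]
  have hp (τ : Fin n → K) (c : K) (ω : Fin n → ℤ) (hc : τ = Function.update (1 : Fin n → K) i c) :
      ∏ j, τ j ^ ω j = c ^ ω i := by
    rw [Finset.prod_eq_single i (fun j _ hj => by simp [hc, hj]) (by simp), hc]
    simp
  have hinv : (Function.update (1 : Fin n → K) i 2)⁻¹ = Function.update (1 : Fin n → K) i 2⁻¹ := by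
    ext j
    by_cases hj : j = i
    · subst hj; simp
    · simp [hj]
  have h1 := euclid_scale hs hτ X Y
  rw [scale_of_mem_multiWeightSpace _ hX, scale_of_mem_multiWeightSpace _ hY, hp _ 2 _ rfl,
    hp _ 2⁻¹ _ hinv, map_smul, map_smul, LinearMap.smul_apply, smul_eq_mul, smul_eq_mul,
    ← mul_assoc, inv_zpow, ← zpow_neg, ← zpow_add₀ two_ne_zero] at h1
  by_contra h0
  have h2 := two_zpow_eq_one (mul_right_cancel₀ h0 (h1.trans (one_mul _).symm))
  omega

theorem euclid_eq_zero_of_weight_ne (hs : s ≠ 0) {l l' : ℤ} (h : l ≠ l')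
    {X Y : A n K} (hX : X ∈ weightSpace n K l) (hY : Y ∈ weightSpace n K l') :
    euclid n s X Y = 0 := by
  have h1 := euclid_scale hs (τ := fun _ => 2) (fun _ => two_ne_zero) X Y
  have hinv : (fun _ => 2 : Fin n → K)⁻¹ = fun _ => 2⁻¹ := rfl
  rw [hinv, scale_of_mem_weightSpace two_ne_zero hX,
    scale_of_mem_weightSpace (inv_ne_zero two_ne_zero) hY, map_smul, map_smul,
    LinearMap.smul_apply, smul_eq_mul, smul_eq_mul,
    ← mul_assoc, inv_zpow, ← zpow_neg, ← zpow_add₀ two_ne_zero] at h1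
  by_contra h0
  have h2 := two_zpow_eq_one (mul_right_cancel₀ h0 (h1.trans (one_mul _).symm))
  omega

/-! ### Decomposition into multi-weight components -/

section Projections

open scoped Classical in
theorem proj_mono (ω : Fin n → ℤ) (p : MIdx n × MIdx n) :
    proj K ω (mono n K p) = if multiWeight p = ω then mono n K p else 0 := by
  rw [proj, constr_mono]

theorem proj_mem (ω : Fin n → ℤ) (X : A n K) : proj K ω X ∈ multiWeightSpace K ω := by
  have hX : X ∈ Submodule.span K (Set.range (mono n K)) := span_mono Submodule.mem_top
  have : Submodule.span K (Set.range (mono n K)) ≤ (multiWeightSpace K ω).comap (proj K ω) := by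
    refine Submodule.span_le.2 ?_
    rintro _ ⟨p, rfl⟩
    change proj K ω (mono n K p) ∈ multiWeightSpace K ω
    rw [proj_mono]
    split_ifs with h
    exacts [Submodule.subset_span ⟨p, h, rfl⟩, zero_mem _]
  exact this hX

theorem exists_finset_proj (X : A n K) : ∃ S : Finset (Fin n → ℤ),
    (∀ ω, ω ∉ S → proj K ω X = 0) ∧ ∀ S', S ⊆ S' → ∑ ω ∈ S', proj K ω X = X := by
  classical
  have hX : X ∈ Submodule.span K (Set.range (mono n K)) := span_mono Submodule.mem_top
  -- Allowing every larger `S'` lets the sets for two summands be merged into their union. It also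
  -- forces the components outside `S` to vanish, since adjoining an index does not change the sum.
  suffices h : ∃ S : Finset (Fin n → ℤ), ∀ S', S ⊆ S' → ∑ ω ∈ S', proj K ω X = X by
    obtain ⟨S, hS⟩ := h
    refine ⟨S, fun ω hω => ?_, hS⟩
    have h1 := hS _ (Finset.subset_cons hω)
    rw [Finset.sum_cons, hS S subset_rfl] at h1
    simpa using h1
  induction hX using Submodule.span_induction with
  | mem X h =>
    obtain ⟨p, rfl⟩ := h
    refine ⟨{multiWeight p}, fun S hS => ?_⟩
    simp only [proj_mono]
    rw [Finset.sum_ite_eq, if_pos (hS (Finset.mem_singleton_self _))]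
  | zero => exact ⟨∅, fun S _ => by simp⟩
  | add X Y _ _ h h' =>
    obtain ⟨S, hS⟩ := h
    obtain ⟨S', hS'⟩ := h'
    refine ⟨S ∪ S', fun U hU => ?_⟩
    simp only [map_add, Finset.sum_add_distrib]
    rw [hS U (Finset.union_subset_left hU), hS' U (Finset.union_subset_right hU)]
  | smul c X _ h =>
    obtain ⟨S, hS⟩ := h
    refine ⟨S, fun U hU => ?_⟩
    simp only [map_smul]
    rw [← Finset.smul_sum, hS U hU]

theorem euclid_eq_finsum_proj (hs : s ≠ 0) (X Y : A n K) :
    (Function.support fun ω => euclid n s (proj K ω X) (proj K ω Y)).Finite ∧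
      euclid n s X Y = ∑ᶠ ω, euclid n s (proj K ω X) (proj K ω Y) := by
  classical
  obtain ⟨S, hS, hS'⟩ := exists_finset_proj X
  obtain ⟨U, -, hU⟩ := exists_finset_proj Y
  have hsub : (Function.support fun ω => euclid n s (proj K ω X) (proj K ω Y)) ⊆
      ↑(S ∪ U) := fun ω hω => by
    by_contra h
    rw [Finset.mem_coe, Finset.mem_union, not_or] at h
    exact hω (by simp [hS ω h.1])
  refine ⟨(S ∪ U).finite_toSet.subset hsub, ?_⟩
  rw [finsum_eq_sum_of_support_subset _ hsub]
  conv_lhs => rw [← hS' (S ∪ U) Finset.subset_union_left, ← hU (S ∪ U) Finset.subset_union_right]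
  simp only [map_sum, LinearMap.sum_apply]
  exact Finset.sum_congr rfl fun ω hω => Finset.sum_eq_single ω
    (fun ω' _ h => euclid_eq_zero_of_multiWeight_ne hs h (proj_mem _ _) (proj_mem _ _))
    fun h => absurd hω h

end Projections

/-! ### Factorization over disjoint sets of variables -/

section Factorization

variable {S S' : Set (Fin n)}

theorem scale_mem_varAlgebra {τ : Fin n → K} (hτ : ∀ i, τ i ≠ 0) {X : A n K}
    (hX : X ∈ varAlgebra K S) : scale τ X ∈ varAlgebra K S := by
  refine varAlgebra_induction (P := fun X => scale τ X ∈ varAlgebra K S) (fun i hi => ?_)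
    (fun i hi => ?_) (fun c => ?_) (fun X Y h h' => ?_) (fun X Y h h' => ?_) hX
  · rw [scale_x]; exact Subalgebra.smul_mem _ (x_mem_varAlgebra hi) _
  · rw [scale_d]; exact Subalgebra.smul_mem _ (d_mem_varAlgebra hi) _
  · rw [scale_algebraMap]; exact Subalgebra.algebraMap_mem _ c
  · rw [map_add]; exact add_mem h h'
  · rw [scale_mul hτ]; exact mul_mem h h'

theorem bar_mem_varAlgebra {X : A n K} (hX : X ∈ varAlgebra K S) :
    bar n K X ∈ varAlgebra K S := by
  refine varAlgebra_induction (P := fun X => bar n K X ∈ varAlgebra K S) (fun i hi => ?_)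
    (fun i hi => ?_) (fun c => ?_) (fun X Y h h' => ?_) (fun X Y h h' => ?_) hX
  · rw [bar_x]; exact d_mem_varAlgebra hi
  · rw [bar_d]; exact x_mem_varAlgebra hi
  · rw [bar_algebraMap]; exact Subalgebra.algebraMap_mem _ c
  · rw [map_add]; exact add_mem h h'
  · rw [bar_mul]; exact mul_mem h' h

theorem euclid_one_one (hs : s ≠ 0) : euclid n s 1 1 = 1 := by
  rw [euclid_eq hs, scale_one, bar_one, one_mul, T_one]

theorem euclid_mul_of_disjoint (hs : s ≠ 0) (h : Disjoint S S') {X X' Y Y' : A n K}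
    (hX : X ∈ varAlgebra K S) (hX' : X' ∈ varAlgebra K S') (hY : Y ∈ varAlgebra K S)
    (hY' : Y' ∈ varAlgebra K S') :
    euclid n s (X * X') (Y * Y') = euclid n s X Y * euclid n s X' Y' := by
  have hW := mul_mem (scale_mem_varAlgebra (τ := fun _ => s) (fun _ => hs) hX')
    (bar_mem_varAlgebra hY')
  have hZ := bar_mem_varAlgebra hY
  rw [euclid_eq hs, euclid_eq hs, euclid_eq hs, ← T_mul_of_disjoint h
    (mul_mem (scale_mem_varAlgebra (fun _ => hs) hX) hZ) hW, scale_mul fun _ => hs, bar_mul]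
  congr 1
  -- `bar Y` lies in the variables `S`, so it commutes past `scale s X' * bar Y'`, which lies in the
  -- variables `S'`.
  rw [mul_assoc, mul_assoc, ← mul_assoc _ (bar n K Y') (bar n K Y),
    ← (commute_of_disjoint h hZ hW).eq]

theorem euclid_list_prod (hs : s ≠ 0) (X Y : Fin n → A n K) (hX : ∀ i, X i ∈ varSpace K i)
    (hY : ∀ i, Y i ∈ varSpace K i) (L : List (Fin n)) (hL : L.Nodup) :
    euclid n s (L.map X).prod (L.map Y).prod = (L.map fun i => euclid n s (X i) (Y i)).prod := by
  have hmem (Z : Fin n → A n K) (hZ : ∀ i, Z i ∈ varSpace K i) (L : List (Fin n)) :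
      (L.map Z).prod ∈ varAlgebra K {i | i ∈ L} := by
    refine list_prod_mem fun W hW => ?_
    obtain ⟨i, hi, rfl⟩ := List.mem_map.1 hW
    exact varAlgebra_mono (Set.singleton_subset_iff.2 hi) (mem_varAlgebra_of_mem_varSpace (hZ i))
  induction L with
  | nil => simp [euclid_one_one hs]
  | cons i L ih =>
    rw [List.nodup_cons] at hL
    simp only [List.map_cons, List.prod_cons]
    rw [euclid_mul_of_disjoint hs (S := {i}) (S' := {j | j ∈ L}) (by simpa using hL.1)
      (mem_varAlgebra_of_mem_varSpace (hX i)) (hmem X hX L)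
      (mem_varAlgebra_of_mem_varSpace (hY i)) (hmem Y hY L), ih hL.2]

end Factorization

/-! ### Positive definiteness -/

section Positivity

/-- Left invariance contributes `2 * s⁻¹` and right invariance `-s`. These combine to `s` times a
commutator because `2 * s⁻¹ = s`, which explains the coefficients `2` and `-1` in `create`. -/
theorem euclid_create (hs : s ^ 2 = 2) (i : Fin n ⊕ Fin n) (X Y : A n K) :
    euclid n s (create n K i X) Y = s * euclid n s X (annihilate n K i Y) := by
  have h0 := ne_zero_of_sq_eq_two hs
  have h2 : 2 * s⁻¹ = s := by rw [← hs]; field_simp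
  rcases i with i | i
  · rw [create_inl, annihilate_inl]
    simp only [map_add, map_smul, LinearMap.add_apply, LinearMap.smul_apply, smul_eq_mul]
    rw [euclid_mul_left hs (x_mem_weightSpace i), euclid_mul_right h0 (x_mem_weightSpace i), bar_x,
      zpow_neg, zpow_one, ← mul_assoc, h2]
    ring
  · rw [create_inr, annihilate_inr]
    simp only [map_add, map_smul, LinearMap.add_apply, LinearMap.smul_apply, smul_eq_mul]
    rw [euclid_mul_left hs (d_mem_weightSpace i), euclid_mul_right h0 (d_mem_weightSpace i), bar_d,
      neg_neg, zpow_neg, zpow_one, ← mul_assoc, h2]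
    ring

theorem euclid_posDef [LinearOrder K] [IsStrictOrderedRing K] (hs : s ^ 2 = 2) (h0 : 0 < s)
    (X : A n K) : 0 ≤ euclid n s X X ∧ (euclid n s X X = 0 → X = 0) :=
  posDef_of_ladder (euclid n s) h0 (euclid_comm h0.ne')
    (by rw [euclid_one_one h0.ne']; exact zero_lt_one) annihilate_one annihilate_create create_comm
    (euclid_create hs) iSup_ladderSpace_create X

theorem length_sq (X : A n ℝ) : length n X ^ 2 = euclid n √2 X X :=
  Real.sq_sqrt (euclid_posDef (Real.sq_sqrt zero_le_two) (by positivity) X).1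

end Positivity

end

end Weyl

open Weyl in
theorem theorem2 (n : ℕ) (K : Type*) [Field K] [CharZero K] (s : K) (hs : s ^ 2 = 2) :
    -- the form is given by `⟨X, Y⟩ = √2 ^ l(X) (X, Ȳ)` for `X` homogeneous of weight `l(X)`
    (∀ (l : ℤ), ∀ X ∈ weightSpace n K l, ∀ Y : A n K,
      euclid n s X Y = s ^ l * frob n K X (bar n K Y)) ∧
    -- symmetry
    (∀ X Y : A n K, euclid n s X Y = euclid n s Y X) ∧
    (∀ X Y : A n K, euclid n s X Y = euclid n s (bar n K X) (bar n K Y)) ∧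
    -- positive definiteness, whenever `K` is an ordered field and `s` is its positive root of `2`
    (∀ [LinearOrder K] [IsStrictOrderedRing K], 0 < s →
      (∀ X : A n K, 0 ≤ euclid n s X X) ∧ (∀ X : A n K, euclid n s X X = 0 → X = 0)) ∧
    -- invariance
    (∀ (l : ℤ), ∀ a ∈ weightSpace n K l, ∀ X Y : A n K,
      euclid n s (a * X) Y = s ^ (-l) * euclid n s X (bar n K a * Y)) ∧
    (∀ (l : ℤ), ∀ a ∈ weightSpace n K l, ∀ X Y : A n K,
      euclid n s (X * a) Y = s ^ l * euclid n s X (Y * bar n K a)) ∧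
    -- orthogonality of the multi-weight spaces and of the weight spaces
    (∀ ω ω' : Fin n → ℤ, ω ≠ ω' → ∀ X ∈ multiWeightSpace K ω, ∀ Y ∈ multiWeightSpace K ω',
      euclid n s X Y = 0) ∧
    (∀ l l' : ℤ, l ≠ l' → ∀ X ∈ weightSpace n K l, ∀ Y ∈ weightSpace n K l',
      euclid n s X Y = 0) ∧
    -- the resulting decompositions of the form and (over the reals) of the squared length
    (∀ X Y : A n K,
      (Function.support fun ω => euclid n s (proj K ω X) (proj K ω Y)).Finite ∧
        euclid n s X Y = ∑ᶠ ω, euclid n s (proj K ω X) (proj K ω Y)) ∧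
    (∀ X : A n ℝ,
      (Function.support fun ω => length n (proj ℝ ω X) ^ 2).Finite ∧
        length n X ^ 2 = ∑ᶠ ω, length n (proj ℝ ω X) ^ 2) ∧
    -- factorization on decomposable elements
    (∀ X Y : Fin n → A n K, (∀ i, X i ∈ varSpace K i) → (∀ i, Y i ∈ varSpace K i) →
      euclid n s (List.ofFn X).prod (List.ofFn Y).prod = ∏ i, euclid n s (X i) (Y i)) := by

  have h0 := ne_zero_of_sq_eq_two hs
  refine ⟨fun l X hX Y => euclid_of_mem_weightSpace h0 hX Y, euclid_comm h0, euclid_bar hs,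
    fun hpos => ⟨fun X => (euclid_posDef hs hpos X).1, fun X => (euclid_posDef hs hpos X).2⟩,
    fun l a ha => euclid_mul_left hs ha, fun l a ha => euclid_mul_right h0 ha,
    fun ω ω' h X hX Y hY => euclid_eq_zero_of_multiWeight_ne h0 h hX hY,
    fun l l' h X hX Y hY => euclid_eq_zero_of_weight_ne h0 h hX hY,
    euclid_eq_finsum_proj h0, fun X => ?_, fun X Y hX hY => ?_⟩
  · simp only [length_sq]
    exact euclid_eq_finsum_proj (by positivity) X X
  · have h := euclid_list_prod h0 X Y hX hY _ (List.nodup_finRange n)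
    rwa [← List.ofFn_eq_map, ← List.ofFn_eq_map, ← List.ofFn_eq_map, List.prod_ofFn (f := fun i => _)] at h
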